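/- Let $V^1$ be the two-sorted theory of bounded arithmetic in the language $\{0,1,+,\cdot,|\ |,=_1,=_2,\le,\in\}$ (number variables, and set variables for finite sets of numbers), axiomatized by 2-BASIC, the induction scheme $\varphi(0)\wedge\forall x(\varphi(x)\to\varphi(x+1))\to\forall z\,\varphi(z)$ for $\Sigma^{1,b}_0$- and $\Sigma^{1,b}_1$-formulas, and the bounded comprehension scheme $\forall x\,\exists X\le x\,\forall y<x\,(y\in X\leftrightarrow\varphi(y))$ for $\Sigma^{1,b}_0$-formulas. Sequences and matrices are coded by sets through the pairing function $\langle x,y\rangle=\frac{(x+y)(x+y+1)}2+y$: a set $C$ is an $m\times k$ matrix over $\mathbb Z_p=\{0,\dots,p-1\}$ if for all $i<m$, $j<k$ there is exactly one $a<p$ with $\langle\langle i,j\rangle,a\rangle\in C$ (then $C_{ij}=a$), and a set $X$ is a vector of length $n$ over $\mathbb Z_p$ if for all $j<n$ there is exactly one $a<p$ with $\langle j,a\rangle\in X$ (then $X_j=a$). Sums $\sum_{j<n}C_{ij}X_j$ in $\mathbb Z_p$ are defined through the existence of the sequence of partial sums. A matrix is in row-echelon form if the first non-zero entry of each non-zero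 row is $1$ and, whenever row $i+1$ is non-zero, row $i$ is non-zero and its first non-zero entry is strictly to the left of that of row $i+1$. **Lemma.** $V^1$ proves the following sentence: for every prime $p$, all $m,n$ and every augmented $m\times(n+1)$ matrix $[A|B]$ over $\mathbb Z_p$ there is an $m\times(n+1)$ matrix $[A'|B']$ over $\mathbb Z_p$ in row-echelon form such that the linear systems $A\bar x=\bar b$ and $A'\bar x=\bar b'$ have the same solutions, i.e. every vector $X$ of length $n$ over $\mathbb Z_p$ satisfies $\sum_{j<n}A_{ij}X_j=B_i$ for all $i<m$ if and only if it satisfies $\sum_{j<n}A'_{ij}X_j=B'_i$ for all $i<m$. -/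

import Mathlib

/-! Two-sorted bounded arithmetic: syntax, a Hilbert-style predicate calculus with equality, the
theory `V1`, and the formulas that speak about matrices over `ℤ/p`.

Variables are de Bruijn indices, counted separately for the two sorts.  In a formula that is not
closed, an index that points beyond all quantifiers of its sort is a free variable. -/

namespace BoundedArith

/-- Number terms.  `var i` is a number variable and `len X` is the length `|X|` of the set
variable `X`.  The only terms of the set sort are the set variables. -/
inductive NTerm : Type
  | var (i : ℕ)
  | zero
  | one
  | add (t s : NTerm)
  | mul (t s : NTerm)
  | len (X : ℕ)

instance : Zero NTerm := ⟨NTerm.zero⟩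
instance : One NTerm := ⟨NTerm.one⟩
instance : Add NTerm := ⟨NTerm.add⟩
instance : Mul NTerm := ⟨NTerm.mul⟩

/-- Formulas.  `allN` binds the number variable `0` and `allS` binds the set variable `0`. -/
inductive Formula : Type
  | eqN (t s : NTerm)
  | eqS (X Y : ℕ)
  | le (t s : NTerm)
  | mem (t : NTerm) (X : ℕ)
  | falsum
  | imp (φ ψ : Formula)
  | allN (φ : Formula)
  | allS (φ : Formula)

/-! ### Substitution -/

/-- Simultaneous substitution of number terms for number variables and of set variables for set
variables. -/
def NTerm.subst (σ : ℕ → NTerm) (ρ : ℕ → ℕ) : NTerm → NTerm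
  | .var i => σ i
  | .zero => .zero
  | .one => .one
  | .add t s => .add (t.subst σ ρ) (s.subst σ ρ)
  | .mul t s => .mul (t.subst σ ρ) (s.subst σ ρ)
  | .len X => .len (ρ X)

/-- Weakening by a new number variable `0`. -/
def NTerm.shiftN (t : NTerm) : NTerm := t.subst (fun i => .var (i + 1)) id

/-- Weakening by a new set variable `0`. -/
def NTerm.shiftS (t : NTerm) : NTerm := t.subst .var Nat.succ

/-- `a, f 0, f 1, …` -/
def scons {α : Type} (a : α) (f : ℕ → α) : ℕ → α
  | 0 => a
  | k + 1 => f k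

/-- Capture-avoiding simultaneous substitution. -/
def Formula.subst : (ℕ → NTerm) → (ℕ → ℕ) → Formula → Formula
  | σ, ρ, .eqN t s => .eqN (t.subst σ ρ) (s.subst σ ρ)
  | _, ρ, .eqS X Y => .eqS (ρ X) (ρ Y)
  | σ, ρ, .le t s => .le (t.subst σ ρ) (s.subst σ ρ)
  | σ, ρ, .mem t X => .mem (t.subst σ ρ) (ρ X)
  | _, _, .falsum => .falsum
  | σ, ρ, .imp φ ψ => .imp (φ.subst σ ρ) (ψ.subst σ ρ)
  | σ, ρ, .allN φ => .allN (φ.subst (scons (.var 0) (fun k => (σ k).shiftN)) ρ)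
  | σ, ρ, .allS φ => .allS (φ.subst (fun k => (σ k).shiftS) (scons 0 (fun k => ρ k + 1)))

namespace Formula

def shiftN (φ : Formula) : Formula := φ.subst (fun i => .var (i + 1)) id
def shiftS (φ : Formula) : Formula := φ.subst .var Nat.succ

/-- `φ(t)`: the term `t` for the number variable `0`; the other number variables move down. -/
def instN (φ : Formula) (t : NTerm) : Formula := φ.subst (scons t .var) id

/-- `φ(Y)`: the set variable `Y` for the set variable `0`; the other set variables move down. -/
def instS (φ : Formula) (Y : ℕ) : Formula := φ.subst .var (scons Y id)

/-- `φ(x + 1)`, where `x` is the number variable `0`. -/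
def instSucc (φ : Formula) : Formula :=
  φ.subst (scons (.var 0 + 1) (fun k => .var (k + 1))) id

/-! ### Defined connectives and quantifiers -/

def neg (φ : Formula) : Formula := imp φ falsum
def or (φ ψ : Formula) : Formula := imp (neg φ) ψ
def and (φ ψ : Formula) : Formula := neg (imp φ (neg ψ))
def iff (φ ψ : Formula) : Formula := and (imp φ ψ) (imp ψ φ)
def exN (φ : Formula) : Formula := neg (allN (neg φ))
def exS (φ : Formula) : Formula := neg (allS (neg φ))
def lt (t s : NTerm) : Formula := and (le t s) (neg (eqN t s))

end Formula

infix:50 " ≐ " => Formula.eqN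
infixr:35 " ⋏ " => Formula.and
infixr:30 " ⋎ " => Formula.or
infixr:25 " ⇒ " => Formula.imp
infix:20 " ⇔ " => Formula.iff

namespace Formula

/-- `∀ x ≤ t, φ`.  The bound `t` lives outside of the quantifier, so `x` does not occur in it. -/
def allLe (t : NTerm) (φ : Formula) : Formula := allN (le (.var 0) t.shiftN ⇒ φ)

/-- `∃ x ≤ t, φ` -/
def exLe (t : NTerm) (φ : Formula) : Formula := exN (le (.var 0) t.shiftN ⋏ φ)

/-- `∀ X ≤ t, φ`, that is, `∀ X, |X| ≤ t → φ` -/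
def allSLe (t : NTerm) (φ : Formula) : Formula := allS (le (.len 0) t.shiftS ⇒ φ)

/-- `∃ X ≤ t, φ`, that is, `∃ X, |X| ≤ t ∧ φ` -/
def exSLe (t : NTerm) (φ : Formula) : Formula := exS (le (.len 0) t.shiftS ⋏ φ)

/-- `∀ x < t, φ` -/
def allLt (t : NTerm) (φ : Formula) : Formula := allLe t (lt (.var 0) t.shiftN ⇒ φ)

/-- `∃ x < t, φ` -/
def exLt (t : NTerm) (φ : Formula) : Formula := exLe t (lt (.var 0) t.shiftN ⋏ φ)

end Formula

open Formula

/-! ### Provability -/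

/-- Derivability from the axioms `T` in classical two-sorted predicate logic with equality
(free variables of axioms and theorems are read universally). -/
inductive Proves (T : Set Formula) : Formula → Prop
  | ax {φ : Formula} (h : φ ∈ T) : Proves T φ
  | mp {φ ψ : Formula} (h₁ : Proves T (φ ⇒ ψ)) (h₂ : Proves T φ) : Proves T ψ
  | genN {φ : Formula} (h : Proves T φ) : Proves T (allN φ)
  | genS {φ : Formula} (h : Proves T φ) : Proves T (allS φ)
  | implyK (φ ψ : Formula) : Proves T (φ ⇒ ψ ⇒ φ)
  | implyS (φ ψ χ : Formula) : Proves T ((φ ⇒ ψ ⇒ χ) ⇒ (φ ⇒ ψ) ⇒ φ ⇒ χ)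
  | dne (φ : Formula) : Proves T (neg (neg φ) ⇒ φ)
  | specN (φ : Formula) (t : NTerm) : Proves T (allN φ ⇒ φ.instN t)
  | specS (φ : Formula) (Y : ℕ) : Proves T (allS φ ⇒ φ.instS Y)
  | distN (φ ψ : Formula) : Proves T (allN (φ ⇒ ψ) ⇒ allN φ ⇒ allN ψ)
  | distS (φ ψ : Formula) : Proves T (allS (φ ⇒ ψ) ⇒ allS φ ⇒ allS ψ)
  | vacN (φ : Formula) : Proves T (φ ⇒ allN φ.shiftN)
  | vacS (φ : Formula) : Proves T (φ ⇒ allS φ.shiftS)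
  | reflN (t : NTerm) : Proves T (t ≐ t)
  | reflS (X : ℕ) : Proves T (eqS X X)
  | replN (φ : Formula) (t s : NTerm) : Proves T (t ≐ s ⇒ φ.instN t ⇒ φ.instN s)
  | replS (φ : Formula) (X Y : ℕ) : Proves T (eqS X Y ⇒ φ.instS X ⇒ φ.instS Y)

/-! ### The classes of bounded formulas -/

/-- Formulas in which all number quantifiers are bounded and there are no set quantifiers. -/
inductive IsSigma0 : Formula → Prop
  | eqN (t s : NTerm) : IsSigma0 (t ≐ s)
  | eqS (X Y : ℕ) : IsSigma0 (Formula.eqS X Y)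
  | le (t s : NTerm) : IsSigma0 (Formula.le t s)
  | mem (t : NTerm) (X : ℕ) : IsSigma0 (Formula.mem t X)
  | falsum : IsSigma0 Formula.falsum
  | imp {φ ψ : Formula} (h₁ : IsSigma0 φ) (h₂ : IsSigma0 ψ) : IsSigma0 (φ ⇒ ψ)
  | allLe (t : NTerm) {φ : Formula} (h : IsSigma0 φ) : IsSigma0 (Formula.allLe t φ)
  | exLe (t : NTerm) {φ : Formula} (h : IsSigma0 φ) : IsSigma0 (Formula.exLe t φ)

mutual

/-- The class of existential bounded formulas of the second order. -/
inductive IsSigma1 : Formula → Prop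
  | sigma0 {φ : Formula} (h : IsSigma0 φ) : IsSigma1 φ
  | or {φ ψ : Formula} (h₁ : IsSigma1 φ) (h₂ : IsSigma1 ψ) : IsSigma1 (φ ⋎ ψ)
  | and {φ ψ : Formula} (h₁ : IsSigma1 φ) (h₂ : IsSigma1 ψ) : IsSigma1 (φ ⋏ ψ)
  | neg {φ : Formula} (h : IsPi1 φ) : IsSigma1 (Formula.neg φ)
  | exSLe (t : NTerm) {φ : Formula} (h : IsSigma1 φ) : IsSigma1 (Formula.exSLe t φ)

/-- The class of universal bounded formulas of the second order. -/
inductive IsPi1 : Formula → Prop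
  | sigma0 {φ : Formula} (h : IsSigma0 φ) : IsPi1 φ
  | or {φ ψ : Formula} (h₁ : IsPi1 φ) (h₂ : IsPi1 ψ) : IsPi1 (φ ⋎ ψ)
  | and {φ ψ : Formula} (h₁ : IsPi1 φ) (h₂ : IsPi1 ψ) : IsPi1 (φ ⋏ ψ)
  | neg {φ : Formula} (h : IsSigma1 φ) : IsPi1 (Formula.neg φ)
  | allSLe (t : NTerm) {φ : Formula} (h : IsPi1 φ) : IsPi1 (Formula.allSLe t φ)

end

/-! ### The theory -/

/-- The axioms 2-BASIC, with `x, y` the number variables `0, 1` and `X, Y` the set variables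
`0, 1`. -/
inductive TwoBasic : Formula → Prop
  | b1 : TwoBasic (neg (.var 0 + 1 ≐ 0))
  | b2 : TwoBasic (.var 0 + 1 ≐ .var 1 + 1 ⇒ .var 0 ≐ .var 1)
  | b3 : TwoBasic (.var 0 + 0 ≐ .var 0)
  | b4 : TwoBasic (.var 0 + (.var 1 + 1) ≐ (.var 0 + .var 1) + 1)
  | b5 : TwoBasic (.var 0 * 0 ≐ 0)
  | b6 : TwoBasic (.var 0 * (.var 1 + 1) ≐ .var 0 * .var 1 + .var 0)
  | b7 : TwoBasic (le (.var 0) (.var 1) ⋏ le (.var 1) (.var 0) ⇒ .var 0 ≐ .var 1)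
  | b8 : TwoBasic (le (.var 0) (.var 0 + .var 1))
  | b9 : TwoBasic (le 0 (.var 0))
  | b10 : TwoBasic (le (.var 0) (.var 1) ⋎ le (.var 1) (.var 0))
  | b11 : TwoBasic (le (.var 0) (.var 1) ⇔ lt (.var 0) (.var 1 + 1))
  | b12 : TwoBasic (neg (.var 0 ≐ 0) ⇒ exLe (.var 0) (.var 0 + 1 ≐ .var 1))
  | l1 : TwoBasic (mem (.var 1) 0 ⇒ lt (.var 1) (.len 0))
  | l2 : TwoBasic (.var 1 + 1 ≐ .len 0 ⇒ mem (.var 1) 0)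
  | se : TwoBasic
      ((.len 0 ≐ .len 1) ⋏ allLt (.len 0) (mem (.var 0) 0 ⇔ mem (.var 0) 1) ⇔ eqS 0 1)

/-- `φ(0) ∧ ∀ x (φ(x) → φ(x + 1)) → ∀ z φ(z)` -/
def indAxiom (φ : Formula) : Formula :=
  φ.instN 0 ⋏ allN (φ ⇒ φ.instSucc) ⇒ allN φ

/-- `∀ x ∃ X ≤ x ∀ y < x (y ∈ X ↔ φ(y))`, where `y, x` are the number variables `0, 1` of `φ`, and
`X` does not occur in `φ`. -/
def compAxiom (φ : Formula) : Formula :=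
  allN (exSLe (.var 0) (allLt (.var 0) (mem (.var 0) 0 ⇔ φ.shiftS)))

/-- 2-BASIC with induction and bounded comprehension for formulas without set quantifiers. -/
def V0 : Set Formula :=
  {θ | TwoBasic θ} ∪ {θ | ∃ φ, IsSigma0 φ ∧ θ = indAxiom φ} ∪ {θ | ∃ φ, IsSigma0 φ ∧ θ = compAxiom φ}

/-- The theory `V¹`. -/
def V1 : Set Formula := V0 ∪ {θ | ∃ φ, IsSigma1 φ ∧ θ = indAxiom φ}

/-! ### Arithmetic modulo `p`, matrices, linear systems

The arguments of these formulas are number terms and set variables, and are weakened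
(`shiftN`, `shiftS`, `+ 1`) whenever a quantifier is crossed. -/

/-- `p` is prime: `1 < p ∧ ∀ y < p, ∀ z < p, y * z ≠ p` -/
def prime (p : NTerm) : Formula :=
  lt 1 p ⋏ allLt p (allLt p.shiftN (neg (.var 1 * .var 0 ≐ p.shiftN.shiftN)))

/-- `z = ⟨x, y⟩ = (x + y)(x + y + 1) / 2 + y` -/
def isPair (x y z : NTerm) : Formula :=
  z + z ≐ (x + y) * (x + y + 1) + (y + y)

/-- `X(x, y)`, that is, `⟨x, y⟩ ∈ X` -/
def mem₂ (X : ℕ) (x y : NTerm) : Formula :=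
  exLt (.len X) (isPair x.shiftN y.shiftN (.var 0) ⋏ mem (.var 0) X)

/-- `X(x, y, w)`, that is, `⟨⟨x, y⟩, w⟩ ∈ X`; below `z = ⟨u, w⟩` is the variable `1` and
`u = ⟨x, y⟩ ≤ z` is the variable `0`. -/
def mem₃ (X : ℕ) (x y w : NTerm) : Formula :=
  exLt (.len X)
    (exLe (.var 0)
        (isPair x.shiftN.shiftN y.shiftN.shiftN (.var 0) ⋏
          isPair (.var 0) w.shiftN.shiftN (.var 1)) ⋏
      mem (.var 0) X)

/-- `r = a mod p` (for `p ≠ 0`): `∃ q ≤ a, a = p * q + r ∧ r < p` -/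
def isRem (a p r : NTerm) : Formula :=
  exLe a (a.shiftN ≐ p.shiftN * .var 0 + r.shiftN) ⋏ lt r p

/-- `a ≡ b (mod p)` -/
def congr (a b p : NTerm) : Formula :=
  exLt p (isRem a.shiftN p.shiftN (.var 0) ⋏ isRem b.shiftN p.shiftN (.var 0))

/-- `c` is the sum of `a` and `b` in `ℤ/p = {0, …, p - 1}`. -/
def addMod (p a b c : NTerm) : Formula := lt c p ⋏ congr c (a + b) p

/-- `c` is the product of `a` and `b` in `ℤ/p = {0, …, p - 1}`. -/
def mulMod (p a b c : NTerm) : Formula := lt c p ⋏ congr c (a * b) p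

/-- `A` is an `m × n` matrix over `ℤ/p`: for all `i < m` and `j < n` there is exactly one `a < p`
with `A(i, j, a)`. -/
def isMatrix (m n p : NTerm) (A : ℕ) : Formula :=
  allLt m (allLt n.shiftN
    (exLt p.shiftN.shiftN (mem₃ A (.var 2) (.var 1) (.var 0)) ⋏
      allLt p.shiftN.shiftN (allLt p.shiftN.shiftN.shiftN
        (mem₃ A (.var 3) (.var 2) (.var 1) ⋏ mem₃ A (.var 3) (.var 2) (.var 0) ⇒
          .var 1 ≐ .var 0))))

/-- `X` is a vector of length `n` over `ℤ/p`: for all `j < n` there is exactly one `a < p` with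
`X(j, a)`. -/
def isVector (n p : NTerm) (X : ℕ) : Formula :=
  allLt n
    (exLt p.shiftN (mem₂ X (.var 1) (.var 0)) ⋏
      allLt p.shiftN (allLt p.shiftN.shiftN
        (mem₂ X (.var 2) (.var 1) ⋏ mem₂ X (.var 2) (.var 0) ⇒ .var 1 ≐ .var 0)))

/-- The row `i` of `A` has its first non-zero entry in the column `j`:
`A(i, j, 0)` fails and `A(i, k, 0)` holds for all `k < j`. -/
def isLeading (A : ℕ) (i j : NTerm) : Formula :=
  neg (mem₃ A i j 0) ⋏ allLt j (mem₃ A i.shiftN (.var 0) 0)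

/-- The `m × n` matrix `A` is in row-echelon form: all first non-zero entries of rows are `1`, and
if the row `i + 1` has its first non-zero entry in the column `j`, then the row `i` has its first
non-zero entry in a column `k < j`.  (So zero rows are at the bottom, and a zero matrix is in
row-echelon form.) -/
def isRowEchelon (m n : NTerm) (A : ℕ) : Formula :=
  allLt m (allLt n.shiftN (isLeading A (.var 1) (.var 0) ⇒ mem₃ A (.var 1) (.var 0) 1)) ⋏
    allLt m (lt (.var 0 + 1) m.shiftN ⇒
      allLt n.shiftN (isLeading A (.var 1 + 1) (.var 0) ⇒
        exLt (.var 0) (isLeading A (.var 2) (.var 0))))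

/-- `S` is the sequence of the `n + 1` partial sums of the product of the row `i` of `A` with the
vector `X`: `S(0) = 0` and `S(k + 1) = S(k) + A(i, k) * X(k)` in `ℤ/p` for all `k < n`.
In the scope of the six quantifiers `k, c, v, t, s, s'` are the variables `5, 4, 3, 2, 1, 0`, where
`c = A(i, k)`, `v = X(k)`, `t = c * v`, `s = S(k)` and `s' = S(k + 1)`. -/
def isPartialSums (n p : NTerm) (A X : ℕ) (i : NTerm) (S : ℕ) : Formula :=
  isVector (n + 1) p S ⋏ mem₂ S 0 0 ⋏
    allLt n
      (let p₁ := p.shiftN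
       let p₂ := p₁.shiftN
       let p₃ := p₂.shiftN
       let p₄ := p₃.shiftN
       let p₅ := p₄.shiftN
       let p₆ := p₅.shiftN
       let i₆ := i.shiftN.shiftN.shiftN.shiftN.shiftN.shiftN
       exLt p₁ (exLt p₂ (exLt p₃ (exLt p₄ (exLt p₅
        (mem₃ A i₆ (.var 5) (.var 4) ⋏ mem₂ X (.var 5) (.var 3) ⋏
          mulMod p₆ (.var 4) (.var 3) (.var 2) ⋏
          mem₂ S (.var 5) (.var 1) ⋏ mem₂ S (.var 5 + 1) (.var 0) ⋏
          addMod p₆ (.var 1) (.var 2) (.var 0)))))))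

/-- `∑_{k < n} A(i, k) * X(k) = b` in `ℤ/p`; the set `S` of partial sums consists of pairs `⟨k, a⟩`
with `k ≤ n` and `a < p`, and so has length at most `(n + p + 1)²`. -/
def isRowProduct (n p : NTerm) (A X : ℕ) (i b : NTerm) : Formula :=
  exSLe ((n + p + 1) * (n + p + 1))
    (isPartialSums n.shiftS p.shiftS (A + 1) (X + 1) i.shiftS 0 ⋏ mem₂ 0 n.shiftS b.shiftS)

/-- `X` solves the system of `m` linear equations in `n` unknowns over `ℤ/p` with the augmented
`m × (n + 1)` matrix `A`: for all `i < m`, `∑_{k < n} A(i, k) * X(k) = A(i, n)`. -/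
def isSolution (m n p : NTerm) (A X : ℕ) : Formula :=
  isVector n p X ⋏
    allLt m (exLt p.shiftN
      (mem₃ A (.var 1) n.shiftN.shiftN (.var 0) ⋏
        isRowProduct n.shiftN.shiftN p.shiftN.shiftN A X (.var 1) (.var 0)))

/-- For all primes `p`, all `m, n` and every augmented `m × (n + 1)` matrix `A` over `ℤ/p` there is
an `m × (n + 1)` matrix `A'` over `ℤ/p` in row-echelon form such that the two linear systems have
the same solutions.  The number variables `2, 1, 0` are `p, m, n`. The set variables are `A` (with
index `0`), then `A', A` (`0, 1`), then `X, A', A` (`0, 1, 2`). -/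
def gaussianElimination : Formula :=
  allN (allN (allN
    (let p : NTerm := .var 2
     let m : NTerm := .var 1
     let n : NTerm := .var 0
     prime p ⇒
      allS (isMatrix m (n + 1) p 0 ⇒
        exS (isMatrix m (n + 1) p 0 ⋏ isRowEchelon m (n + 1) 0 ⋏
          allS (isSolution m n p 2 0 ⇔ isSolution m n p 1 0))))))

end BoundedArith

namespace BoundedArith

/-! ### Substitution calculus -/

-- No derivation in the calculus is written out. By the completeness theorem
-- `proves_of_forall_model`, proved by Henkin's construction, it suffices that the sentence holds in
-- every model of `V1` whose numbers are values of terms and whose sets are values of variables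
-- under one fixed valuation. In such a model every number and every set may serve as a parameter of
-- a formula.
--
-- Inside a model the numbers form a discretely ordered commutative semiring with pairing and
-- division with remainder, and for prime `p` every non-zero residue is invertible
-- (`IsPrime.exists_inv`). The classes `S0` and `F0` collect the predicates definable by Σ₀-formulas
-- and the term-bounded functions with Σ₀ graph. They are closed under the constructions used here,
-- so that instance search settles nearly all side conditions of induction and comprehension.
--
-- `Echelon.step` clears one column. It has to be iterated a possibly nonstandard number of times,
-- so the whole run of the elimination is coded by one set `H` of bounded length, which exists by
-- Σ₁-induction on the number of treated columns (`exists_history`). The invariant under the set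
-- quantifier must be Σ₀. For this reason row equivalence of successive matrices is recorded through
-- `Comb`: each row of one matrix is a combination of two rows of the other, with bounded witnesses.
--
-- Having the same solutions is a statement about all sets `X` and is not part of that invariant.
-- Instead, `X` is fixed afterwards, and a second Σ₁-induction (`exists_table`) yields one set `T`
-- with the partial sums of the products of `X` with all rows of all matrices in `H`. Relative to
-- `H` and `T`, the statement that `X` solves the `t`-th system is Σ₀. `Comb.equations` carries it
-- from `t` to `t + 1` and back, and Σ₀-induction on `t` connects the first system with the last.

theorem comp_scons {α β : Type} (f : α → β) (a : α) (g : ℕ → α) :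
    (fun i => f (scons a g i)) = scons (f a) (fun i => f (g i)) := by
  funext i; cases i <;> rfl

theorem NTerm.subst_subst (t : NTerm) (σ σ' : ℕ → NTerm) (ρ ρ' : ℕ → ℕ) :
    (t.subst σ ρ).subst σ' ρ' = t.subst (fun i => (σ i).subst σ' ρ') (fun i => ρ' (ρ i)) := by
  induction t <;> simp_all [NTerm.subst]

theorem NTerm.subst_var (t : NTerm) : t.subst NTerm.var id = t := by
  induction t <;> simp_all [NTerm.subst]

theorem Formula.subst_subst (φ : Formula) (σ σ' : ℕ → NTerm) (ρ ρ' : ℕ → ℕ) :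
    (φ.subst σ ρ).subst σ' ρ' = φ.subst (fun i => (σ i).subst σ' ρ') (fun i => ρ' (ρ i)) := by
  induction φ generalizing σ σ' ρ ρ' with
  | allN φ ih =>
    simp only [Formula.subst, ih, Formula.allN.injEq]
    congr 1
    funext i
    cases i with
    | zero => rfl
    | succ i => simp [scons, NTerm.shiftN, NTerm.subst_subst, NTerm.subst]
  | allS φ ih =>
    simp only [Formula.subst, ih, Formula.allS.injEq]
    congr 1
    · funext i
      simp [NTerm.shiftS, NTerm.subst_subst, NTerm.subst, scons]
    · funext i
      cases i <;> rfl
  | _ => simp_all [Formula.subst, NTerm.subst_subst]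

theorem scons_var_shift : scons (NTerm.var 0) (fun k => (NTerm.var k).shiftN) = NTerm.var := by
  funext i; cases i <;> rfl

theorem scons_zero_id : scons 0 (fun k => id k + 1) = id := by
  funext i; cases i <;> rfl

theorem Formula.subst_var (φ : Formula) : φ.subst NTerm.var id = φ := by
  induction φ with
  | allN φ ih => simp only [Formula.subst, scons_var_shift, ih]
  | allS φ ih =>
    simp only [Formula.subst, scons_zero_id]
    exact congrArg _ ih
  | _ => simp_all [Formula.subst, NTerm.subst_var]

/-- A strict upper bound of the indices of the number variables of a term. -/
def NTerm.boundN : NTerm → ℕ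
  | .var i => i + 1
  | .add t s => max t.boundN s.boundN
  | .mul t s => max t.boundN s.boundN
  | _ => 0

/-- A strict upper bound of the indices of the set variables of a term. -/
def NTerm.boundS : NTerm → ℕ
  | .len X => X + 1
  | .add t s => max t.boundS s.boundS
  | .mul t s => max t.boundS s.boundS
  | _ => 0

/-- A strict upper bound of the indices of the number variables of a formula. -/
def Formula.boundN : Formula → ℕ
  | .eqN t s => max t.boundN s.boundN
  | .le t s => max t.boundN s.boundN
  | .mem t _ => t.boundN
  | .imp φ ψ => max φ.boundN ψ.boundN
  | .allN φ => φ.boundN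
  | .allS φ => φ.boundN
  | _ => 0

/-- A strict upper bound of the indices of the set variables of a formula. -/
def Formula.boundS : Formula → ℕ
  | .eqN t s => max t.boundS s.boundS
  | .eqS X Y => max X Y + 1
  | .le t s => max t.boundS s.boundS
  | .mem t X => max t.boundS (X + 1)
  | .imp φ ψ => max φ.boundS ψ.boundS
  | .allN φ => φ.boundS
  | .allS φ => φ.boundS
  | .falsum => 0

theorem NTerm.subst_congr (t : NTerm) {σ σ' : ℕ → NTerm} {ρ ρ' : ℕ → ℕ}
    (h : ∀ i < t.boundN, σ i = σ' i) (h' : ∀ i < t.boundS, ρ i = ρ' i) :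
    t.subst σ ρ = t.subst σ' ρ' := by
  induction t <;> simp_all [NTerm.subst, NTerm.boundN, NTerm.boundS]

theorem Formula.subst_congr (φ : Formula) {σ σ' : ℕ → NTerm} {ρ ρ' : ℕ → ℕ}
    (h : ∀ i < φ.boundN, σ i = σ' i) (h' : ∀ i < φ.boundS, ρ i = ρ' i) :
    φ.subst σ ρ = φ.subst σ' ρ' := by
  induction φ generalizing σ σ' ρ ρ' with
  | allN φ ih =>
    simp only [Formula.subst, Formula.allN.injEq]
    refine ih (fun i hi => ?_) h'
    cases i with
    | zero => rfl
    | succ i => simp only [scons]; rw [h i (by simp only [Formula.boundN]; omega)]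
  | allS φ ih =>
    simp only [Formula.subst, Formula.allS.injEq]
    refine ih (fun i hi => by rw [h i hi]) (fun i hi => ?_)
    cases i with
    | zero => rfl
    | succ i => simp only [scons]; rw [h' i (by simp only [Formula.boundS]; omega)]
  | imp φ ψ ih₁ ih₂ =>
    simp only [Formula.subst, Formula.boundN, Formula.boundS, lt_max_iff] at *
    rw [ih₁ (fun i hi => h i (.inl hi)) (fun i hi => h' i (.inl hi)),
      ih₂ (fun i hi => h i (.inr hi)) (fun i hi => h' i (.inr hi))]
  | eqN t s =>
    simp only [Formula.subst, Formula.boundN, Formula.boundS, lt_max_iff] at *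
    rw [t.subst_congr (fun i hi => h i (.inl hi)) (fun i hi => h' i (.inl hi)),
      s.subst_congr (fun i hi => h i (.inr hi)) (fun i hi => h' i (.inr hi))]
  | le t s =>
    simp only [Formula.subst, Formula.boundN, Formula.boundS, lt_max_iff] at *
    rw [t.subst_congr (fun i hi => h i (.inl hi)) (fun i hi => h' i (.inl hi)),
      s.subst_congr (fun i hi => h i (.inr hi)) (fun i hi => h' i (.inr hi))]
  | eqS X Y =>
    simp only [Formula.subst, Formula.boundS] at *
    rw [h' X (by omega), h' Y (by omega)]
  | mem t X =>
    simp only [Formula.subst, Formula.boundN, Formula.boundS, lt_max_iff] at *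
    rw [t.subst_congr h (fun i hi => h' i (.inl hi)), h' X (.inr (by omega))]
  | falsum => rfl

/-- Renaming of set variables. -/
def Formula.renS (r : ℕ → ℕ) (φ : Formula) : Formula := φ.subst .var r

-- Closure of provability under simultaneous substitution.

namespace Proves

variable {T : Set Formula}

/-- The calculus only instantiates the variable `0`, so a simultaneous substitution is obtained by
generalizing and instantiating once for each variable of `φ`. It makes axioms with free variables
valid under all valuations and lets fresh variables be renamed. -/
theorem substN {φ : Formula} (h : Proves T φ) (σ : ℕ → NTerm) : Proves T (φ.subst σ id) := by
  -- After `j` rounds the first `j` variables are replaced and the others have moved down by `j`.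
  -- Each later instantiation lowers the indices by one, so the inserted terms are shifted in
  -- advance by the number of remaining rounds; this also protects them from being generalized.
  have key : ∀ j ≤ φ.boundN, Proves T (φ.subst (fun i => if i < j then
      (σ i).subst (fun l => .var (l + (φ.boundN - j))) id else .var (i - j)) id) := by
    intro j
    induction j with
    | zero => intro _; simpa [Formula.subst_var] using h
    | succ j ih =>
      intro hj
      have h₁ := Proves.mp (Proves.specN _
        ((σ j).subst (fun l => .var (l + (φ.boundN - (j + 1)))) id)) (ih (by omega)).genN
      unfold Formula.instN at h₁
      rw [Formula.subst_subst] at h₁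
      refine (congrArg (fun σ => Proves T (φ.subst σ id)) (funext fun i => ?_)).mp h₁
      rcases lt_trichotomy i j with h₂ | h₂ | h₂
      · rw [if_pos h₂, if_pos (by omega), NTerm.subst_subst]
        refine NTerm.subst_congr _ (fun l _ => ?_) (fun _ _ => rfl)
        rw [show l + (φ.boundN - j) = l + (φ.boundN - (j + 1)) + 1 by omega]
        rfl
      · subst h₂
        rw [if_neg (by omega), if_pos (by omega), show i - i = 0 by omega]
        rfl
      · rw [if_neg (by omega), if_neg (by omega), show i - j = i - (j + 1) + 1 by omega]
        rfl
  refine (congrArg (Proves T) (φ.subst_congr (fun i hi => ?_) (fun _ _ => rfl))).mp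
    (key _ le_rfl)
  simp only [if_pos hi, Nat.sub_self, Nat.add_zero, NTerm.subst_var]

theorem renS {φ : Formula} (h : Proves T φ) (r : ℕ → ℕ) : Proves T (φ.renS r) := by
  have key : ∀ j ≤ φ.boundS, Proves T
      (φ.renS (fun i => if i < j then r i + (φ.boundS - j) else i - j)) := by
    intro j
    induction j with
    | zero =>
      intro _
      have : (fun i => if i < 0 then r i + (φ.boundS - 0) else i - 0) = id := by funext i; simp
      rw [this, Formula.renS, Formula.subst_var]
      exact h
    | succ j ih =>
      intro hj
      have h₁ := Proves.mp (Proves.specS _ (r j + (φ.boundS - (j + 1)))) (ih (by omega)).genS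
      unfold Formula.instS Formula.renS at h₁
      rw [Formula.subst_subst] at h₁
      refine (congrArg (fun ρ => Proves T (φ.subst .var ρ)) (funext fun i => ?_)).mp h₁
      rcases lt_trichotomy i j with h₂ | h₂ | h₂
      · rw [if_pos h₂, if_pos (by omega),
          show r i + (φ.boundS - j) = r i + (φ.boundS - (j + 1)) + 1 by omega]
        rfl
      · subst h₂
        rw [if_neg (by omega), if_pos (by omega), show i - i = 0 by omega]
        rfl
      · rw [if_neg (by omega), if_neg (by omega), show i - j = i - (j + 1) + 1 by omega]
        rfl
  exact (congrArg (Proves T)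
    (φ.subst_congr (fun _ _ => rfl) (fun i hi => by simp [hi]))).mp (key _ le_rfl)

/-! ### Propositional reasoning -/

theorem impI (ψ : Formula) {φ : Formula} (h : Proves T φ) : Proves T (ψ ⇒ φ) :=
  (implyK _ _).mp h

theorem impMp {δ φ ψ : Formula} (h : Proves T (δ ⇒ φ ⇒ ψ)) (h' : Proves T (δ ⇒ φ)) :
    Proves T (δ ⇒ ψ) :=
  ((implyS _ _ _).mp h).mp h'

theorem impRefl (φ : Formula) : Proves T (φ ⇒ φ) :=
  impMp (implyK φ (φ ⇒ φ)) (implyK φ φ)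

theorem trans {φ ψ χ : Formula} (h : Proves T (φ ⇒ ψ)) (h' : Proves T (ψ ⇒ χ)) :
    Proves T (φ ⇒ χ) :=
  impMp (impI _ h') h

/-- Application under two hypotheses. -/
theorem impMp₂ {α β φ ψ : Formula} (h : Proves T (α ⇒ β ⇒ φ ⇒ ψ)) (h' : Proves T (α ⇒ β ⇒ φ)) :
    Proves T (α ⇒ β ⇒ ψ) :=
  impMp (h.trans (implyS _ _ _)) h'

theorem exfalso {δ φ : Formula} (h : Proves T (δ ⇒ Formula.falsum)) : Proves T (δ ⇒ φ) :=
  h.trans ((implyK _ _).trans (dne φ))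

/-- Proof by contradiction under a hypothesis. -/
theorem byContra {δ φ : Formula} (h : Proves T (δ ⇒ φ.neg ⇒ Formula.falsum)) :
    Proves T (δ ⇒ φ) :=
  Proves.trans h (dne φ)

theorem impSwap {α β φ : Formula} (h : Proves T (α ⇒ β ⇒ φ)) : Proves T (β ⇒ α ⇒ φ) :=
  impMp₂ (impI β h) (implyK β α)

theorem andI (φ ψ : Formula) : Proves T (φ ⇒ ψ ⇒ (φ ⋏ ψ)) := by
  have h₁ : Proves T ((φ ⇒ ψ.neg) ⇒ φ ⇒ ψ.neg) := impRefl _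
  have h₂ : Proves T (φ ⇒ (φ ⇒ ψ.neg) ⇒ ψ.neg) := impSwap h₁
  have h₃ : Proves T (φ ⇒ ψ ⇒ (φ ⇒ ψ.neg) ⇒ Formula.falsum) := by
    have h₄ : Proves T (((φ ⇒ ψ.neg) ⇒ ψ.neg) ⇒ ψ ⇒ (φ ⇒ ψ.neg) ⇒ Formula.falsum) := by
      refine impSwap ?_
      have h₅ : Proves T (ψ ⇒ ψ.neg ⇒ Formula.falsum) := impSwap (impRefl ψ.neg)
      exact h₅.trans ((implyK _ _).trans (implyS _ _ _))
    exact h₂.trans h₄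
  exact h₃

theorem andL (φ ψ : Formula) : Proves T ((φ ⋏ ψ) ⇒ φ) := by
  refine byContra (impSwap ?_)
  have h₁ : Proves T (φ.neg ⇒ φ ⇒ ψ.neg) :=
    impMp₂ (impI _ (impI _ ((implyK _ _).trans (dne _)))) (impRefl φ.neg)
  exact h₁.trans (impSwap (impRefl _))

theorem andR (φ ψ : Formula) : Proves T ((φ ⋏ ψ) ⇒ ψ) := by
  refine byContra (impSwap ?_)
  exact (implyK ψ.neg φ).trans (impSwap (impRefl _))

theorem andIntro {δ φ ψ : Formula} (h : Proves T ((δ ⋏ φ) ⇒ ψ)) : Proves T (δ ⇒ φ ⇒ ψ) :=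
  impMp₂ (impI _ (impI _ h)) (andI _ _)

end Proves

/-! ### Structures and satisfaction -/

/-- Two-sorted structures for the language of bounded arithmetic. -/
structure Str where
  N : Type
  S : Type
  zero : N
  one : N
  add : N → N → N
  mul : N → N → N
  le : N → N → Prop
  len : S → N
  mem : N → S → Prop

/-- The value of a number term. -/
def NTerm.eval (M : Str) (v : ℕ → M.N) (w : ℕ → M.S) : NTerm → M.N
  | .var i => v i
  | .zero => M.zero
  | .one => M.one
  | .add t s => M.add (t.eval M v w) (s.eval M v w)
  | .mul t s => M.mul (t.eval M v w) (s.eval M v w)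
  | .len X => M.len (w X)

/-- Tarskian satisfaction. -/
def Sat (M : Str) : (ℕ → M.N) → (ℕ → M.S) → Formula → Prop
  | v, w, .eqN t s => t.eval M v w = s.eval M v w
  | _, w, .eqS X Y => w X = w Y
  | v, w, .le t s => M.le (t.eval M v w) (s.eval M v w)
  | v, w, .mem t X => M.mem (t.eval M v w) (w X)
  | _, _, .falsum => False
  | v, w, .imp φ ψ => Sat M v w φ → Sat M v w ψ
  | v, w, .allN φ => ∀ x, Sat M (scons x v) w φ
  | v, w, .allS φ => ∀ X, Sat M v (scons X w) φ

/-! ### Coding of formulas -/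

def NTerm.code : NTerm → ℕ
  | .var i => Nat.pair 0 i
  | .zero => Nat.pair 1 0
  | .one => Nat.pair 2 0
  | .add t s => Nat.pair 3 (Nat.pair t.code s.code)
  | .mul t s => Nat.pair 4 (Nat.pair t.code s.code)
  | .len X => Nat.pair 5 X

theorem NTerm.code_injective : Function.Injective NTerm.code := by
  intro t
  induction t <;> intro s h <;> cases s <;> simp_all [NTerm.code, Nat.pair_eq_pair]
  · exact ⟨by aesop, by aesop⟩
  · exact ⟨by aesop, by aesop⟩

def Formula.code : Formula → ℕ
  | .eqN t s => Nat.pair 0 (Nat.pair t.code s.code)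
  | .eqS X Y => Nat.pair 1 (Nat.pair X Y)
  | .le t s => Nat.pair 2 (Nat.pair t.code s.code)
  | .mem t X => Nat.pair 3 (Nat.pair t.code X)
  | .falsum => Nat.pair 4 0
  | .imp φ ψ => Nat.pair 5 (Nat.pair φ.code ψ.code)
  | .allN φ => Nat.pair 6 φ.code
  | .allS φ => Nat.pair 7 φ.code

theorem Formula.code_injective : Function.Injective Formula.code := by
  intro φ
  induction φ <;> intro ψ h <;> cases ψ <;>
    simp_all [Formula.code, Nat.pair_eq_pair, NTerm.code_injective.eq_iff]
  · exact ⟨by aesop, by aesop⟩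
  · aesop
  · aesop

/-- The Henkin construction decides the formulas one after the other along an enumeration. -/
instance : Countable Formula := Formula.code_injective.countable

instance : Nonempty Formula := ⟨.falsum⟩

/-! ### Complete Henkin theories -/

/-- `T` does not refute `χ`. -/
def Con (T : Set Formula) (χ : Formula) : Prop := ¬ Proves T χ.neg

variable {T : Set Formula}

theorem Con.and_or {χ : Formula} (h : Con T χ) (φ : Formula) (h' : ¬ Con T (χ ⋏ φ)) :
    Con T (χ ⋏ φ.neg) := by
  intro h₁
  have h₂ : Proves T (χ ⇒ φ.neg) := Proves.andIntro (not_not.1 h')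
  exact h (Proves.impMp (Proves.andIntro h₁) h₂)

/-- A counterexample to `θ` may be named by a variable that occurs neither in `δ` nor in `θ`: if
this were refutable, generalizing that variable would prove `allN θ` from `δ ⋏ (allN θ).neg`. -/
theorem Con.henkinN {δ θ : Formula} (h : Con T (δ ⋏ (Formula.allN θ).neg)) :
    Con T ((δ ⋏ (Formula.allN θ).neg) ⋏ (θ.instN (.var (max δ.boundN θ.boundN))).neg) := by
  set i := max δ.boundN θ.boundN with hi
  intro h₁
  have h₂ : Proves T ((δ ⋏ (Formula.allN θ).neg) ⇒ θ.instN (.var i)) :=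
    Proves.byContra (Proves.andIntro h₁)
  -- The fresh variable becomes the variable `0` and all others move up, which is the shape that
  -- `vacN` and `distN` require for generalization.
  have h₃ := h₂.substN (fun j => .var (if j = i then 0 else j + 1))
  have e₁ : (δ ⋏ (Formula.allN θ).neg).subst (fun j => .var (if j = i then 0 else j + 1)) id =
      (δ ⋏ (Formula.allN θ).neg).shiftN := by
    refine Formula.subst_congr _ (fun j hj => ?_) (fun _ _ => rfl)
    have : j ≠ i := by
      simp only [Formula.and, Formula.neg, Formula.boundN] at hj
      omega
    simp only [if_neg this]
  have e₂ : (θ.instN (.var i)).subst (fun j => .var (if j = i then 0 else j + 1)) id = θ := by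
    unfold Formula.instN
    rw [Formula.subst_subst]
    conv_rhs => rw [← Formula.subst_var θ]
    refine Formula.subst_congr _ (fun j hj => ?_) (fun _ _ => rfl)
    cases j with
    | zero => simp [scons, NTerm.subst]
    | succ j =>
      have : j ≠ i := by omega
      simp only [scons, NTerm.subst, if_neg this]
  have h₄ : Proves T ((δ ⋏ (Formula.allN θ).neg).shiftN ⇒ θ) := by
    rw [← e₁]; conv => arg 2; arg 2; rw [← e₂]
    exact h₃
  have h₅ := (Proves.vacN (δ ⋏ (Formula.allN θ).neg)).trans ((Proves.distN _ _).mp h₄.genN)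
  exact h (Proves.impMp (Proves.andR _ _) h₅)

theorem Con.henkinS {δ θ : Formula} (h : Con T (δ ⋏ (Formula.allS θ).neg)) :
    Con T ((δ ⋏ (Formula.allS θ).neg) ⋏ (θ.instS (max δ.boundS θ.boundS)).neg) := by
  set i := max δ.boundS θ.boundS with hi
  intro h₁
  have h₂ : Proves T ((δ ⋏ (Formula.allS θ).neg) ⇒ θ.instS i) :=
    Proves.byContra (Proves.andIntro h₁)
  have h₃ := h₂.renS (fun j => if j = i then 0 else j + 1)
  have e₁ : (δ ⋏ (Formula.allS θ).neg).renS (fun j => if j = i then 0 else j + 1) =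
      (δ ⋏ (Formula.allS θ).neg).shiftS := by
    refine Formula.subst_congr _ (fun _ _ => rfl) (fun j hj => ?_)
    have : j ≠ i := by
      simp only [Formula.and, Formula.neg, Formula.boundS] at hj
      omega
    simp only [if_neg this]
  have e₂ : (θ.instS i).renS (fun j => if j = i then 0 else j + 1) = θ := by
    unfold Formula.instS Formula.renS
    rw [Formula.subst_subst]
    conv_rhs => rw [← Formula.subst_var θ]
    refine Formula.subst_congr _ (fun _ _ => rfl) (fun j hj => ?_)
    cases j with
    | zero => simp [scons]
    | succ j =>
      have : j ≠ i := by omega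
      exact if_neg this
  have h₄ : Proves T ((δ ⋏ (Formula.allS θ).neg).shiftS ⇒ θ) := by
    rw [← e₁]; conv => arg 2; arg 2; rw [← e₂]
    exact h₃
  have h₅ := (Proves.vacS (δ ⋏ (Formula.allS θ).neg)).trans ((Proves.distS _ _).mp h₄.genS)
  exact h (Proves.impMp (Proves.andR _ _) h₅)

/-- `φ` is a universal formula that `χ` refutes at some variable. -/
def HenkinWitness (T : Set Formula) (χ φ : Formula) : Prop :=
  (∀ θ, φ = .allN θ → ∃ t, Proves T (χ ⇒ (θ.instN t).neg)) ∧
  (∀ θ, φ = .allS θ → ∃ Y, Proves T (χ ⇒ (θ.instS Y).neg))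

theorem exists_extension {χ : Formula} (h : Con T χ) (φ : Formula) :
    ∃ χ', Con T χ' ∧ Proves T (χ' ⇒ χ) ∧
      (Proves T (χ' ⇒ φ) ∨ Proves T (χ' ⇒ φ.neg) ∧ HenkinWitness T χ' φ) := by
  by_cases h₁ : Con T (χ ⋏ φ)
  · exact ⟨_, h₁, Proves.andL _ _, .inl (Proves.andR _ _)⟩
  have h₂ := h.and_or φ h₁
  cases φ with
  | allN θ =>
    refine ⟨_, h₂.henkinN, (Proves.andL _ _).trans (Proves.andL _ _),
      .inr ⟨(Proves.andL _ _).trans (Proves.andR _ _), ?_, by simp⟩⟩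
    rintro _ ⟨rfl⟩
    exact ⟨_, Proves.andR _ _⟩
  | allS θ =>
    refine ⟨_, h₂.henkinS, (Proves.andL _ _).trans (Proves.andL _ _),
      .inr ⟨(Proves.andL _ _).trans (Proves.andR _ _), by simp, ?_⟩⟩
    rintro _ ⟨rfl⟩
    exact ⟨_, Proves.andR _ _⟩
  | _ => exact ⟨_, h₂, Proves.andL _ _, .inr ⟨Proves.andR _ _, by simp [HenkinWitness]⟩⟩

/-- Complete theories with witnesses. -/
structure IsHenkin (T Γ : Set Formula) : Prop where
  mem_of_proves {φ : Formula} (h : Proves T φ) : φ ∈ Γ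
  mp {φ ψ : Formula} (h : (φ ⇒ ψ) ∈ Γ) (h' : φ ∈ Γ) : ψ ∈ Γ
  falsum : Formula.falsum ∉ Γ
  complete (φ : Formula) : φ ∈ Γ ∨ φ.neg ∈ Γ
  witN {θ : Formula} (h : ∀ t, θ.instN t ∈ Γ) : Formula.allN θ ∈ Γ
  witS {θ : Formula} (h : ∀ Y, θ.instS Y ∈ Γ) : Formula.allS θ ∈ Γ

/-- The theory is the set of consequences of an increasing chain of single formulas `c n`, each
consistent with `T`. Since a stage is one formula, only finitely many variables are in use and a
fresh witness always exists. -/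
theorem exists_isHenkin {χ : Formula} (h : Con T χ) : ∃ Γ, IsHenkin T Γ ∧ χ ∈ Γ := by
  obtain ⟨f, hf⟩ := exists_surjective_nat Formula
  choose! ext hc hi hw using fun χ (h : Con T χ) φ => exists_extension (T := T) h φ
  let c : ℕ → Formula := fun n => Nat.rec χ (fun n χ => ext χ (f n)) n
  have hcon : ∀ n, Con T (c n) := by
    intro n
    induction n with
    | zero => exact h
    | succ n ih => exact hc _ ih _
  have hmono : ∀ n k, Proves T (c (n + k) ⇒ c n) := by
    intro n k
    induction k with
    | zero => exact Proves.impRefl _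
    | succ k ih => exact (hi _ (hcon (n + k)) (f (n + k))).trans ih
  have hmono' : ∀ {n k φ}, n ≤ k → Proves T (c n ⇒ φ) → Proves T (c k ⇒ φ) := by
    intro n k φ hk h
    obtain ⟨k, rfl⟩ := Nat.exists_eq_add_of_le hk
    exact (hmono n k).trans h
  have hno : ∀ φ n k, Proves T (c n ⇒ φ) → ¬ Proves T (c k ⇒ φ.neg) := fun φ n k h₁ h₂ =>
    hcon (max n k) (Proves.impMp (hmono' (le_max_right _ _) h₂) (hmono' (le_max_left _ _) h₁))
  have hstep : ∀ φ, ∃ n, Proves T (c n ⇒ φ) ∨ Proves T (c n ⇒ φ.neg) ∧ HenkinWitness T (c n) φ := by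
    intro φ
    obtain ⟨n, rfl⟩ := hf φ
    exact ⟨n + 1, hw _ (hcon n) (f n)⟩
  refine ⟨{φ | ∃ n, Proves T (c n ⇒ φ)}, ⟨?_, ?_, ?_, ?_, ?_, ?_⟩, 0, Proves.impRefl _⟩
  · exact fun h => ⟨0, Proves.impI _ h⟩
  · rintro φ ψ ⟨n, h₁⟩ ⟨k, h₂⟩
    exact ⟨max n k, Proves.impMp (hmono' (le_max_left _ _) h₁) (hmono' (le_max_right _ _) h₂)⟩
  · rintro ⟨n, h₁⟩
    exact hcon n h₁
  · intro φ
    obtain ⟨n, h₁ | h₁⟩ := hstep φ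
    · exact .inl ⟨n, h₁⟩
    · exact .inr ⟨n, h₁.1⟩
  · intro θ h₁
    obtain ⟨n, h₂ | h₂⟩ := hstep (.allN θ)
    · exact ⟨n, h₂⟩
    · obtain ⟨t, h₃⟩ := h₂.2.1 θ rfl
      obtain ⟨k, h₄⟩ := h₁ t
      exact (hno _ _ _ h₄ h₃).elim
  · intro θ h₁
    obtain ⟨n, h₂ | h₂⟩ := hstep (.allS θ)
    · exact ⟨n, h₂⟩
    · obtain ⟨t, h₃⟩ := h₂.2.2 θ rfl
      obtain ⟨k, h₄⟩ := h₁ t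
      exact (hno _ _ _ h₄ h₃).elim

/-! ### The term model -/

namespace IsHenkin

variable {Γ : Set Formula} (H : IsHenkin T Γ)

theorem imp_mem_iff (H : IsHenkin T Γ) {φ ψ : Formula} : (φ ⇒ ψ) ∈ Γ ↔ (φ ∈ Γ → ψ ∈ Γ) := by
  refine ⟨fun h h' => H.mp h h', fun h => ?_⟩
  rcases H.complete φ with h₁ | h₁
  · exact H.mp (H.mem_of_proves (Proves.implyK _ _)) (h h₁)
  · exact H.mp (H.mem_of_proves (Proves.impMp₂ (Proves.impI _ (Proves.impI _
      (Proves.exfalso (Proves.impRefl _)))) (Proves.impRefl φ.neg))) h₁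

theorem allN_mem_iff (H : IsHenkin T Γ) {φ : Formula} :
    Formula.allN φ ∈ Γ ↔ ∀ t, φ.instN t ∈ Γ :=
  ⟨fun h _ => H.mp (H.mem_of_proves (Proves.specN _ _)) h, H.witN⟩

theorem allS_mem_iff (H : IsHenkin T Γ) {φ : Formula} :
    Formula.allS φ ∈ Γ ↔ ∀ Y, φ.instS Y ∈ Γ :=
  ⟨fun h _ => H.mp (H.mem_of_proves (Proves.specS _ _)) h, H.witS⟩

theorem shiftN_subst (t u : NTerm) : t.shiftN.subst (scons u .var) id = t := by
  rw [NTerm.shiftN, NTerm.subst_subst]; exact t.subst_var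

theorem replN (H : IsHenkin T Γ) (φ : Formula) {t s : NTerm} (h : (t ≐ s) ∈ Γ)
    (h' : φ.instN t ∈ Γ) : φ.instN s ∈ Γ :=
  H.mp (H.mp (H.mem_of_proves (Proves.replN φ t s)) h) h'

theorem replS (H : IsHenkin T Γ) (φ : Formula) {X Y : ℕ} (h : Formula.eqS X Y ∈ Γ)
    (h' : φ.instS X ∈ Γ) : φ.instS Y ∈ Γ :=
  H.mp (H.mp (H.mem_of_proves (Proves.replS φ X Y)) h) h'

theorem eqN_refl (H : IsHenkin T Γ) (t : NTerm) : (t ≐ t) ∈ Γ := H.mem_of_proves (.reflN t)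

theorem eqS_refl (H : IsHenkin T Γ) (X : ℕ) : Formula.eqS X X ∈ Γ := H.mem_of_proves (.reflS X)

theorem eqN_symm (H : IsHenkin T Γ) {t s : NTerm} (h : (t ≐ s) ∈ Γ) : (s ≐ t) ∈ Γ := by
  simpa [Formula.instN, Formula.subst, NTerm.subst, scons, shiftN_subst] using
    H.replN (.var 0 ≐ t.shiftN) h
      (by simpa [Formula.instN, Formula.subst, NTerm.subst, scons, shiftN_subst] using H.eqN_refl t)

theorem eqN_trans (H : IsHenkin T Γ) {t s u : NTerm} (h : (t ≐ s) ∈ Γ) (h' : (s ≐ u) ∈ Γ) :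
    (t ≐ u) ∈ Γ := by
  simpa [Formula.instN, Formula.subst, NTerm.subst, scons, shiftN_subst] using
    H.replN (t.shiftN ≐ .var 0) h'
      (by simpa [Formula.instN, Formula.subst, NTerm.subst, scons, shiftN_subst] using h)

theorem eqS_symm (H : IsHenkin T Γ) {X Y : ℕ} (h : Formula.eqS X Y ∈ Γ) :
    Formula.eqS Y X ∈ Γ :=
  H.replS (.eqS 0 (X + 1)) h (H.eqS_refl X)

theorem eqS_trans (H : IsHenkin T Γ) {X Y Z : ℕ} (h : Formula.eqS X Y ∈ Γ)
    (h' : Formula.eqS Y Z ∈ Γ) : Formula.eqS X Z ∈ Γ :=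
  H.replS (.eqS (X + 1) 0) h' h

/-- Equality of number terms in a Henkin theory. -/
def setoidN (H : IsHenkin T Γ) : Setoid NTerm :=
  ⟨fun t s => (t ≐ s) ∈ Γ, H.eqN_refl, H.eqN_symm, H.eqN_trans⟩

/-- Equality of set variables in a Henkin theory. -/
def setoidS (H : IsHenkin T Γ) : Setoid ℕ :=
  ⟨fun X Y => Formula.eqS X Y ∈ Γ, H.eqS_refl, H.eqS_symm, H.eqS_trans⟩

/-- `replN` replaces a term at one place of a formula, so the two arguments are exchanged one at a
time. The congruence lemmas make the operations of the term model well defined. -/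
theorem add_congr (H : IsHenkin T Γ) {t t' s s' : NTerm} (h : (t ≐ t') ∈ Γ) (h' : (s ≐ s') ∈ Γ) :
    (t.add s ≐ t'.add s') ∈ Γ := by
  have h₁ : (t.add s ≐ t'.add s) ∈ Γ := by
    simpa [Formula.instN, Formula.subst, NTerm.subst, scons, shiftN_subst] using
      H.replN (t.shiftN.add s.shiftN ≐ (NTerm.var 0).add s.shiftN) h
        (by simpa [Formula.instN, Formula.subst, NTerm.subst, scons, shiftN_subst] using
          H.eqN_refl _)
  simpa [Formula.instN, Formula.subst, NTerm.subst, scons, shiftN_subst] using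
    H.replN (t.shiftN.add s.shiftN ≐ t'.shiftN.add (NTerm.var 0)) h'
      (by simpa [Formula.instN, Formula.subst, NTerm.subst, scons, shiftN_subst] using h₁)

theorem mul_congr (H : IsHenkin T Γ) {t t' s s' : NTerm} (h : (t ≐ t') ∈ Γ) (h' : (s ≐ s') ∈ Γ) :
    (t.mul s ≐ t'.mul s') ∈ Γ := by
  have h₁ : (t.mul s ≐ t'.mul s) ∈ Γ := by
    simpa [Formula.instN, Formula.subst, NTerm.subst, scons, shiftN_subst] using
      H.replN (t.shiftN.mul s.shiftN ≐ (NTerm.var 0).mul s.shiftN) h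
        (by simpa [Formula.instN, Formula.subst, NTerm.subst, scons, shiftN_subst] using
          H.eqN_refl _)
  simpa [Formula.instN, Formula.subst, NTerm.subst, scons, shiftN_subst] using
    H.replN (t.shiftN.mul s.shiftN ≐ t'.shiftN.mul (NTerm.var 0)) h'
      (by simpa [Formula.instN, Formula.subst, NTerm.subst, scons, shiftN_subst] using h₁)

theorem le_congr (H : IsHenkin T Γ) {t t' s s' : NTerm} (h : (t ≐ t') ∈ Γ) (h' : (s ≐ s') ∈ Γ)
    (hle : Formula.le t s ∈ Γ) : Formula.le t' s' ∈ Γ := by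
  have h₁ : Formula.le t' s ∈ Γ := by
    simpa [Formula.instN, Formula.subst, NTerm.subst, scons, shiftN_subst] using
      H.replN (.le (.var 0) s.shiftN) h
        (by simpa [Formula.instN, Formula.subst, NTerm.subst, scons, shiftN_subst] using hle)
  simpa [Formula.instN, Formula.subst, NTerm.subst, scons, shiftN_subst] using
    H.replN (.le t'.shiftN (.var 0)) h'
      (by simpa [Formula.instN, Formula.subst, NTerm.subst, scons, shiftN_subst] using h₁)

theorem mem_congr (H : IsHenkin T Γ) {t t' : NTerm} {X Y : ℕ} (h : (t ≐ t') ∈ Γ)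
    (h' : Formula.eqS X Y ∈ Γ) (hle : Formula.mem t X ∈ Γ) : Formula.mem t' Y ∈ Γ := by
  have h₁ : Formula.mem t' X ∈ Γ := H.replN (.mem (.var 0) X) h hle
  have e : ∀ Z, Formula.instS (.mem (t'.subst .var Nat.succ) 0) Z = Formula.mem t' Z := by
    intro Z
    simp only [Formula.instS, Formula.subst, NTerm.subst_subst]
    exact congrArg (Formula.mem · Z) t'.subst_var
  rw [← e]
  exact H.replS _ h' (by rwa [e])

theorem len_congr (H : IsHenkin T Γ) {X Y : ℕ} (h : Formula.eqS X Y ∈ Γ) :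
    (NTerm.len X ≐ NTerm.len Y) ∈ Γ :=
  H.replS (NTerm.len (X + 1) ≐ .len 0) h (H.eqN_refl _)

/-- The term model of a Henkin theory. -/
def termModel (H : IsHenkin T Γ) : Str where
  N := Quotient H.setoidN
  S := Quotient H.setoidS
  zero := Quotient.mk _ .zero
  one := Quotient.mk _ .one
  add := Quotient.map₂ NTerm.add (fun _ _ h _ _ h' => H.add_congr h h')
  mul := Quotient.map₂ NTerm.mul (fun _ _ h _ _ h' => H.mul_congr h h')
  le := Quotient.lift₂ (fun t s => Formula.le t s ∈ Γ) (fun _ _ _ _ h h' => propext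
    ⟨H.le_congr h h', H.le_congr (H.eqN_symm h) (H.eqN_symm h')⟩)
  len := Quotient.map NTerm.len (fun _ _ h => H.len_congr h)
  mem := Quotient.lift₂ (fun t X => Formula.mem t X ∈ Γ) (fun _ _ _ _ h h' => propext
    ⟨H.mem_congr h h', H.mem_congr (H.eqN_symm h) (H.eqS_symm h')⟩)

/-- The element of the term model denoted by a term. -/
def mkN (H : IsHenkin T Γ) (t : NTerm) : H.termModel.N := Quotient.mk H.setoidN t

/-- The set of the term model denoted by a variable. -/
def mkS (H : IsHenkin T Γ) (X : ℕ) : H.termModel.S := Quotient.mk H.setoidS X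

theorem eval_termModel (H : IsHenkin T Γ) (σ : ℕ → NTerm) (ρ : ℕ → ℕ) (t : NTerm) :
    t.eval H.termModel (fun i => H.mkN (σ i)) (fun i => H.mkS (ρ i)) = H.mkN (t.subst σ ρ) := by
  induction t with
  | add t s ht hs => simp only [NTerm.eval, ht, hs]; rfl
  | mul t s ht hs => simp only [NTerm.eval, ht, hs]; rfl
  | _ => rfl

/-- The truth lemma. It is stated for arbitrary substitutions because the induction passes under
quantifiers, where an element of the model is a class of terms and is absorbed into the
substitution. -/
theorem sat_termModel (H : IsHenkin T Γ) (σ : ℕ → NTerm) (ρ : ℕ → ℕ) (φ : Formula) :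
    Sat H.termModel (fun i => H.mkN (σ i)) (fun i => H.mkS (ρ i)) φ ↔ φ.subst σ ρ ∈ Γ := by
  induction φ generalizing σ ρ with
  | eqN t s =>
    simp only [Sat, eval_termModel]
    exact Quotient.eq (r := H.setoidN)
  | eqS X Y => exact Quotient.eq (r := H.setoidS)
  | le t s => simp only [Sat, eval_termModel]; rfl
  | mem t X => simp only [Sat, eval_termModel]; rfl
  | falsum => exact ⟨False.elim, H.falsum⟩
  | imp φ ψ h₁ h₂ => simp only [Sat, h₁, h₂, Formula.subst, H.imp_mem_iff]
  | allN φ ih =>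
    simp only [Sat, Formula.subst, H.allN_mem_iff]
    have e : ∀ t, (φ.subst (scons (.var 0) (fun k => (σ k).shiftN)) ρ).instN t =
        φ.subst (scons t σ) ρ := by
      intro t
      unfold Formula.instN
      rw [Formula.subst_subst]
      refine Formula.subst_congr _ (fun i _ => ?_) (fun _ _ => rfl)
      cases i
      · rfl
      · exact shiftN_subst _ _
    have e' : ∀ t, scons (H.mkN t) (fun i => H.mkN (σ i)) = fun i => H.mkN (scons t σ i) :=
      fun t => (comp_scons H.mkN t σ).symm
    constructor
    · intro h t
      rw [e, ← ih, ← e']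
      exact h _
    · intro h x
      obtain ⟨t, rfl⟩ : ∃ t, H.mkN t = x := Quotient.exists_rep x
      rw [e', ih, ← e]
      exact h t
  | allS φ ih =>
    simp only [Sat, Formula.subst, H.allS_mem_iff]
    have e : ∀ Y, (φ.subst (fun k => (σ k).shiftS) (scons 0 (fun k => ρ k + 1))).instS Y =
        φ.subst σ (scons Y ρ) := by
      intro t
      unfold Formula.instS
      rw [Formula.subst_subst]
      refine Formula.subst_congr _ (fun i _ => ?_) (fun i _ => ?_)
      · rw [NTerm.shiftS, NTerm.subst_subst]; exact NTerm.subst_var _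
      · cases i <;> rfl
    have e' : ∀ Y, scons (H.mkS Y) (fun i => H.mkS (ρ i)) = fun i => H.mkS (scons Y ρ i) :=
      fun Y => (comp_scons H.mkS Y ρ).symm
    constructor
    · intro h t
      rw [e, ← ih, ← e']
      exact h _
    · intro h x
      obtain ⟨t, rfl⟩ : ∃ t, H.mkS t = x := Quotient.exists_rep x
      rw [e', ih, ← e]
      exact h t

end IsHenkin

/-- Models of `T` in which every element is denoted by a term with respect to a fixed valuation of
the variables. -/
structure Model (T : Set Formula) extends Str where
  nvar : ℕ → N
  svar : ℕ → S
  nvar_surj : ∀ x, ∃ t : NTerm, t.eval toStr nvar svar = x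
  svar_surj : ∀ X, ∃ i, svar i = X
  sat_ax : ∀ φ ∈ T, ∀ v w, Sat toStr v w φ

/-- The completeness theorem. -/
theorem proves_of_forall_model {ψ : Formula}
    (h : ∀ M : Model T, Sat M.toStr M.nvar M.svar ψ) : Proves T ψ := by
  by_contra hψ
  have hc : Con T ψ.neg := fun h' => hψ ((Proves.dne _).mp h')
  obtain ⟨Γ, H, hΓ⟩ := exists_isHenkin hc
  have key : ∀ φ, Sat H.termModel (fun i => H.mkN (.var i)) (fun i => H.mkS i) φ ↔ φ ∈ Γ := by
    intro φ
    have := H.sat_termModel .var id φ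
    rwa [Formula.subst_var] at this
  let M : Model T :=
    { H.termModel with
      nvar := fun i => H.mkN (.var i)
      svar := H.mkS
      nvar_surj := fun x => by
        obtain ⟨t, rfl⟩ : ∃ t, H.mkN t = x := Quotient.exists_rep x
        exact ⟨t, (H.eval_termModel .var id t).trans (by rw [NTerm.subst_var])⟩
      svar_surj := fun x => Quotient.exists_rep x
      sat_ax := by
        intro φ hφ v w
        choose σ hσ using fun i => Quotient.exists_rep (v i)
        choose ρ hρ using fun i => Quotient.exists_rep (w i)
        obtain rfl : (fun i => H.mkN (σ i)) = v := funext hσ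
        obtain rfl : (fun i => H.mkS (ρ i)) = w := funext hρ
        rw [H.sat_termModel]
        -- The set variables are renamed first, so that those inside the terms `σ i` stay as they
        -- are.
        have h₁ := ((Proves.ax hφ).renS ρ).substN σ
        rw [Formula.renS, Formula.subst_subst] at h₁
        exact H.mem_of_proves h₁ }
  exact H.falsum (H.mp hΓ ((key ψ).1 (h M)))

/-! ### Satisfaction of substitutions and of the defined connectives -/

theorem NTerm.eval_subst (M : Str) (v : ℕ → M.N) (w : ℕ → M.S) (t : NTerm) (σ : ℕ → NTerm)
    (ρ : ℕ → ℕ) :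
    (t.subst σ ρ).eval M v w = t.eval M (fun i => (σ i).eval M v w) (fun i => w (ρ i)) := by
  induction t <;> simp_all [NTerm.subst, NTerm.eval]

@[simp] theorem NTerm.eval_shiftN (M : Str) (v : ℕ → M.N) (w : ℕ → M.S) (x : M.N) (t : NTerm) :
    t.shiftN.eval M (scons x v) w = t.eval M v w := by
  rw [NTerm.shiftN, NTerm.eval_subst]; rfl

@[simp] theorem NTerm.eval_shiftS (M : Str) (v : ℕ → M.N) (w : ℕ → M.S) (X : M.S) (t : NTerm) :
    t.shiftS.eval M v (scons X w) = t.eval M v w := by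
  rw [NTerm.shiftS, NTerm.eval_subst]; rfl

theorem sat_subst (M : Str) (v : ℕ → M.N) (w : ℕ → M.S) (φ : Formula) (σ : ℕ → NTerm)
    (ρ : ℕ → ℕ) :
    Sat M v w (φ.subst σ ρ) ↔ Sat M (fun i => (σ i).eval M v w) (fun i => w (ρ i)) φ := by
  induction φ generalizing v w σ ρ with
  | allN φ ih =>
    simp only [Formula.subst, Sat, ih]
    refine forall_congr' fun x => ?_
    rw [show (fun i => (scons (NTerm.var 0) (fun k => (σ k).shiftN) i).eval M (scons x v) w) =
      scons x (fun i => (σ i).eval M v w) from ?_]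
    funext i
    cases i
    · rfl
    · exact NTerm.eval_shiftN _ _ _ _ _
  | allS φ ih =>
    simp only [Formula.subst, Sat, ih, NTerm.eval_shiftS]
    refine forall_congr' fun x => ?_
    rw [show (fun i => scons x w (scons 0 (fun k => ρ k + 1) i)) =
      scons x (fun i => w (ρ i)) from ?_]
    funext i
    cases i <;> rfl
  | _ => simp_all [Formula.subst, Sat, NTerm.eval_subst]

section Connectives

variable (M : Str) (v : ℕ → M.N) (w : ℕ → M.S) (φ ψ : Formula) (t s : NTerm)

@[simp] theorem sat_imp : Sat M v w (φ ⇒ ψ) ↔ (Sat M v w φ → Sat M v w ψ) := Iff.rfl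

@[simp] theorem sat_neg : Sat M v w φ.neg ↔ ¬ Sat M v w φ := Iff.rfl

@[simp] theorem sat_and : Sat M v w (φ ⋏ ψ) ↔ Sat M v w φ ∧ Sat M v w ψ := by
  simp only [Formula.and, sat_neg, sat_imp]; tauto

@[simp] theorem sat_or : Sat M v w (φ ⋎ ψ) ↔ Sat M v w φ ∨ Sat M v w ψ := by
  simp only [Formula.or, sat_neg, sat_imp]; tauto

@[simp] theorem sat_iff : Sat M v w (φ ⇔ ψ) ↔ (Sat M v w φ ↔ Sat M v w ψ) := by
  simp only [Formula.iff, sat_and, sat_imp]; tauto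

@[simp] theorem sat_allN : Sat M v w (.allN φ) ↔ ∀ x, Sat M (scons x v) w φ := Iff.rfl

@[simp] theorem sat_allS : Sat M v w (.allS φ) ↔ ∀ X, Sat M v (scons X w) φ := Iff.rfl

@[simp] theorem sat_exN : Sat M v w φ.exN ↔ ∃ x, Sat M (scons x v) w φ := by
  simp [Formula.exN]

@[simp] theorem sat_exS : Sat M v w φ.exS ↔ ∃ X, Sat M v (scons X w) φ := by
  simp [Formula.exS]

end Connectives

instance (M : Str) : Zero M.N := ⟨M.zero⟩
instance (M : Str) : One M.N := ⟨M.one⟩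
instance (M : Str) : Add M.N := ⟨M.add⟩
instance (M : Str) : Mul M.N := ⟨M.mul⟩
instance (M : Str) : LE M.N := ⟨M.le⟩
instance (M : Str) : LT M.N := ⟨fun x y => x ≤ y ∧ x ≠ y⟩

theorem Str.lt_def {M : Str} (x y : M.N) : x < y ↔ x ≤ y ∧ x ≠ y := Iff.rfl

section Atoms

variable (M : Str) (v : ℕ → M.N) (w : ℕ → M.S) (φ : Formula) (t s : NTerm)

@[simp] theorem eval_var (i : ℕ) : (NTerm.var i).eval M v w = v i := rfl
@[simp] theorem eval_zero : (0 : NTerm).eval M v w = 0 := rfl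
@[simp] theorem eval_one : (1 : NTerm).eval M v w = 1 := rfl
@[simp] theorem eval_add : (t + s).eval M v w = t.eval M v w + s.eval M v w := rfl
@[simp] theorem eval_mul : (t * s).eval M v w = t.eval M v w * s.eval M v w := rfl
@[simp] theorem eval_len (X : ℕ) : (NTerm.len X).eval M v w = M.len (w X) := rfl

@[simp] theorem scons_zero {α : Type} (a : α) (f : ℕ → α) : scons a f 0 = a := rfl
@[simp] theorem scons_one {α : Type} (a : α) (f : ℕ → α) : scons a f 1 = f 0 := rfl
@[simp] theorem scons_two {α : Type} (a : α) (f : ℕ → α) : scons a f 2 = f 1 := rfl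
@[simp] theorem scons_three {α : Type} (a : α) (f : ℕ → α) : scons a f 3 = f 2 := rfl
@[simp] theorem scons_succ {α : Type} (a : α) (f : ℕ → α) (k : ℕ) : scons a f (k + 1) = f k := rfl

@[simp] theorem sat_eqN : Sat M v w (t ≐ s) ↔ t.eval M v w = s.eval M v w := Iff.rfl
@[simp] theorem sat_le : Sat M v w (.le t s) ↔ t.eval M v w ≤ s.eval M v w := Iff.rfl
@[simp] theorem sat_mem (X : ℕ) : Sat M v w (.mem t X) ↔ M.mem (t.eval M v w) (w X) := Iff.rfl
@[simp] theorem sat_lt : Sat M v w (.lt t s) ↔ t.eval M v w < s.eval M v w := by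
  simp [Formula.lt, Str.lt_def]

@[simp] theorem sat_allLe :
    Sat M v w (.allLe t φ) ↔ ∀ x, x ≤ t.eval M v w → Sat M (scons x v) w φ := by
  simp [Formula.allLe]

@[simp] theorem sat_exLe :
    Sat M v w (.exLe t φ) ↔ ∃ x, x ≤ t.eval M v w ∧ Sat M (scons x v) w φ := by
  simp [Formula.exLe]

@[simp] theorem sat_allLt :
    Sat M v w (.allLt t φ) ↔ ∀ x, x < t.eval M v w → Sat M (scons x v) w φ := by
  simp only [Formula.allLt, sat_allLe, sat_imp, sat_lt, eval_var, scons_zero, NTerm.eval_shiftN]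
  exact forall_congr' fun x => ⟨fun h h' => h h'.1 h', fun h _ => h⟩

@[simp] theorem sat_exLt :
    Sat M v w (.exLt t φ) ↔ ∃ x, x < t.eval M v w ∧ Sat M (scons x v) w φ := by
  simp only [Formula.exLt, sat_exLe, sat_and, sat_lt, eval_var, scons_zero, NTerm.eval_shiftN]
  exact exists_congr fun x => ⟨fun h => h.2, fun h => ⟨h.1.1, h⟩⟩

@[simp] theorem sat_exSLe :
    Sat M v w (.exSLe t φ) ↔ ∃ X, M.len X ≤ t.eval M v w ∧ Sat M v (scons X w) φ := by
  simp [Formula.exSLe]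

end Atoms

theorem IsSigma0.subst {φ : Formula} (h : IsSigma0 φ) (σ : ℕ → NTerm) (ρ : ℕ → ℕ) :
    IsSigma0 (φ.subst σ ρ) := by
  have e : ∀ (σ : ℕ → NTerm) (ρ : ℕ → ℕ) (t : NTerm), t.shiftN.subst
      (scons (.var 0) (fun k => (σ k).shiftN)) ρ = (t.subst σ ρ).shiftN := by
    intro σ ρ t
    rw [NTerm.shiftN, NTerm.shiftN, NTerm.subst_subst, NTerm.subst_subst]
    rfl
  induction h generalizing σ ρ with
  | eqN t s => exact .eqN _ _
  | eqS X Y => exact .eqS _ _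
  | le t s => exact .le _ _
  | mem t X => exact .mem _ _
  | falsum => exact .falsum
  | imp h₁ h₂ ih₁ ih₂ => exact .imp (ih₁ _ _) (ih₂ _ _)
  | allLe t h ih =>
    have := IsSigma0.allLe (t.subst σ ρ) (ih (scons (.var 0) (fun k => (σ k).shiftN)) ρ)
    rwa [Formula.allLe, ← e] at this
  | exLe t h ih =>
    have := IsSigma0.exLe (t.subst σ ρ) (ih (scons (.var 0) (fun k => (σ k).shiftN)) ρ)
    rwa [Formula.exLe, ← e] at this

/-! ### Definable predicates on contexts -/

/-- A type of tuples, together with the valuations of the variables that they determine; behind the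
entries of the tuple come the variables of the fixed valuation of `M`. -/
class Ctx (M : Model V1) (E : Type) where
  nv : E → ℕ → M.N
  sv : E → ℕ → M.S
  liftN : ℕ → ℕ
  liftS : ℕ → ℕ
  nv_lift : ∀ e i, nv e (liftN i) = M.nvar i
  sv_lift : ∀ e i, sv e (liftS i) = M.svar i

variable {M : Model V1}

/-- `Bool` plays the role of the empty tuple: both of its elements carry the fixed valuation. -/
instance Ctx.bool : Ctx M Bool := ⟨fun _ => M.nvar, fun _ => M.svar, id, id, by simp, by simp⟩

instance Ctx.prodN {E : Type} [Ctx M E] : Ctx M (E × M.N) where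
  nv q := scons q.2 (Ctx.nv q.1)
  sv q := Ctx.sv q.1
  liftN i := Ctx.liftN M E i + 1
  liftS i := Ctx.liftS M E i
  nv_lift q i := Ctx.nv_lift q.1 i
  sv_lift q i := Ctx.sv_lift q.1 i

instance Ctx.prodS {E : Type} [Ctx M E] : Ctx M (E × M.S) where
  nv q := Ctx.nv q.1
  sv q := scons q.2 (Ctx.sv q.1)
  liftN i := Ctx.liftN M E i
  liftS i := Ctx.liftS M E i + 1
  nv_lift q i := Ctx.nv_lift q.1 i
  sv_lift q i := Ctx.sv_lift q.1 i

section Classes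

variable (M)
variable {E F : Type} [Ctx M E] [Ctx M F]

/-- `f` is the value of a term. -/
class Tm (f : E → M.N) : Prop where
  out : ∃ t : NTerm, ∀ e, t.eval M.toStr (Ctx.nv e) (Ctx.sv e) = f e

/-- `g` is the value of a set variable. -/
class SV (g : E → M.S) : Prop where
  out : ∃ i, ∀ e, Ctx.sv e i = g e

/-- `π` is a substitution. -/
class Pr (π : E → F) : Prop where
  out : ∃ (σ : ℕ → NTerm) (ρ : ℕ → ℕ), ∀ e,
    (∀ i, Ctx.nv (π e) i = (σ i).eval M.toStr (Ctx.nv e) (Ctx.sv e)) ∧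
    (∀ i, Ctx.sv (M := M) (π e) i = Ctx.sv e (ρ i))

/-- `P` is definable by a bounded formula without set quantifiers. -/
class S0 (P : E → Prop) : Prop where
  out : ∃ φ, IsSigma0 φ ∧ ∀ e, Sat M.toStr (Ctx.nv e) (Ctx.sv e) φ ↔ P e

end Classes

section Instances

variable {E F : Type} [Ctx M E] [Ctx M F]

instance Pr.id : Pr M (fun e : E => e) := ⟨NTerm.var, fun i => i, fun _ => ⟨fun _ => rfl, fun _ => rfl⟩⟩

instance Pr.fstN (π : E → F × M.N) [h : Pr M π] : Pr M (fun e => (π e).1) := by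
  obtain ⟨σ, ρ, h⟩ := h
  exact ⟨fun i => σ (i + 1), ρ, fun e => ⟨fun i => (h e).1 (i + 1), fun i => (h e).2 i⟩⟩

instance Pr.fstS (π : E → F × M.S) [h : Pr M π] : Pr M (fun e => (π e).1) := by
  obtain ⟨σ, ρ, h⟩ := h
  exact ⟨σ, fun i => ρ (i + 1), fun e => ⟨fun i => (h e).1 i, fun i => (h e).2 (i + 1)⟩⟩

instance Tm.snd (π : E → F × M.N) [h : Pr M π] : Tm M (fun e => (π e).2) := by
  obtain ⟨σ, ρ, h⟩ := h
  exact ⟨σ 0, fun e => ((h e).1 0).symm⟩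

instance SV.snd (π : E → F × M.S) [h : Pr M π] : SV M (fun e => (π e).2) := by
  obtain ⟨σ, ρ, h⟩ := h
  exact ⟨ρ 0, fun e => ((h e).2 0).symm⟩

/-- Parameters cost nothing: `c` is the value of a term at the fixed valuation, whose variables
remain available behind the entries of the tuple. -/
instance Tm.const (c : M.N) : Tm M (fun _ : E => c) := by
  obtain ⟨t, rfl⟩ := M.nvar_surj c
  refine ⟨t.subst (fun i => .var (Ctx.liftN M E i)) (Ctx.liftS M E), fun e => ?_⟩
  rw [NTerm.eval_subst]
  simp only [eval_var, Ctx.nv_lift, Ctx.sv_lift]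

instance SV.const (X : M.S) : SV M (fun _ : E => X) := by
  obtain ⟨i, rfl⟩ := M.svar_surj X
  exact ⟨Ctx.liftS M E i, fun e => Ctx.sv_lift e i⟩

instance Tm.add (f g : E → M.N) [hf : Tm M f] [hg : Tm M g] : Tm M (fun e => f e + g e) := by
  obtain ⟨t, ht⟩ := hf
  obtain ⟨s, hs⟩ := hg
  exact ⟨t + s, fun e => by rw [eval_add, ht, hs]⟩

instance Tm.mul (f g : E → M.N) [hf : Tm M f] [hg : Tm M g] : Tm M (fun e => f e * g e) := by
  obtain ⟨t, ht⟩ := hf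
  obtain ⟨s, hs⟩ := hg
  exact ⟨t * s, fun e => by rw [eval_mul, ht, hs]⟩

/-- Substitution of a term for the last variable. -/
theorem Pr.pair (f : E → M.N) [hf : Tm M f] : Pr M (fun e => (e, f e)) := by
  obtain ⟨t, ht⟩ := hf
  refine ⟨scons t .var, fun i => i, fun e => ⟨fun i => ?_, fun i => rfl⟩⟩
  cases i
  · exact (ht e).symm
  · rfl

/-- Weakening below the last variable. -/
theorem Pr.lift (π : E → F) [h : Pr M π] : Pr M (fun q : E × M.N => (π q.1, q.2)) := by
  obtain ⟨σ, ρ, h⟩ := h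
  refine ⟨scons (.var 0) (fun i => (σ i).shiftN), ρ, fun q => ⟨fun i => ?_, fun i => (h q.1).2 i⟩⟩
  cases i
  · rfl
  · exact ((h q.1).1 _).trans (NTerm.eval_shiftN _ _ _ _ _).symm

theorem Tm.comp (π : E → F) [h : Pr M π] (f : F → M.N) [hf : Tm M f] :
    Tm M (fun e => f (π e)) := by
  obtain ⟨t, ht⟩ := hf
  obtain ⟨σ, ρ, h⟩ := h
  refine ⟨t.subst σ ρ, fun e => ?_⟩
  rw [NTerm.eval_subst, ← ht]
  congr 1
  · exact funext fun i => ((h e).1 i).symm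
  · exact funext fun i => ((h e).2 i).symm

theorem S0.comp (π : E → F) [h : Pr M π] (P : F → Prop) [hP : S0 M P] :
    S0 M (fun e => P (π e)) := by
  obtain ⟨φ, h₀, hφ⟩ := hP
  obtain ⟨σ, ρ, h⟩ := h
  refine ⟨φ.subst σ ρ, h₀.subst _ _, fun e => ?_⟩
  rw [sat_subst, ← hφ]
  rw [show (fun i => (σ i).eval M.toStr (Ctx.nv e) (Ctx.sv e)) = Ctx.nv (π e) from
    funext fun i => ((h e).1 i).symm,
    show (fun i => Ctx.sv e (ρ i)) = Ctx.sv (π e) from funext fun i => ((h e).2 i).symm]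

theorem S0.congr {P Q : E → Prop} (h : ∀ e, P e ↔ Q e) [hP : S0 M P] : S0 M Q := by
  obtain ⟨φ, h₀, hφ⟩ := hP
  exact ⟨φ, h₀, fun e => (hφ e).trans (h e)⟩

/-- A proposition that does not depend on the tuple has a truth value decided outside the model, so
a trivially true or false formula defines it. -/
instance S0.const (P : Prop) : S0 M (fun _ : E => P) := by
  by_cases h : P
  · exact ⟨.imp .falsum .falsum, .imp .falsum .falsum, fun e => by simp [h]⟩
  · exact ⟨.falsum, .falsum, fun e => by simp [h, Sat]⟩

instance S0.imp (P Q : E → Prop) [hP : S0 M P] [hQ : S0 M Q] : S0 M (fun e => P e → Q e) := by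
  obtain ⟨φ, h₀, hφ⟩ := hP
  obtain ⟨ψ, h₁, hψ⟩ := hQ
  exact ⟨.imp φ ψ, .imp h₀ h₁, fun e => by rw [sat_imp, hφ, hψ]⟩

instance S0.not (P : E → Prop) [hP : S0 M P] : S0 M (fun e => ¬ P e) :=
  S0.imp P (fun _ => False)

instance S0.and (P Q : E → Prop) [hP : S0 M P] [hQ : S0 M Q] : S0 M (fun e => P e ∧ Q e) :=
  S0.congr (P := fun e => ¬ (P e → ¬ Q e)) fun e => by tauto

instance S0.or (P Q : E → Prop) [hP : S0 M P] [hQ : S0 M Q] : S0 M (fun e => P e ∨ Q e) :=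
  S0.congr (P := fun e => (¬ P e → Q e)) fun e => by tauto

instance S0.iff (P Q : E → Prop) [hP : S0 M P] [hQ : S0 M Q] : S0 M (fun e => P e ↔ Q e) :=
  S0.congr (P := fun e => (P e → Q e) ∧ (Q e → P e)) fun e => by tauto

/-- The versions for terms serve the first inductions, from which the semiring and the order of the
model are built. The versions for definable functions presuppose that order and come later. -/
theorem S0.eqTm (f g : E → M.N) [hf : Tm M f] [hg : Tm M g] : S0 M (fun e => f e = g e) := by
  obtain ⟨t, ht⟩ := hf
  obtain ⟨s, hs⟩ := hg
  exact ⟨t ≐ s, .eqN _ _, fun e => by rw [sat_eqN, ht, hs]⟩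

theorem S0.leTm (f g : E → M.N) [hf : Tm M f] [hg : Tm M g] : S0 M (fun e => f e ≤ g e) := by
  obtain ⟨t, ht⟩ := hf
  obtain ⟨s, hs⟩ := hg
  exact ⟨.le t s, .le _ _, fun e => by rw [sat_le, ht, hs]⟩

theorem S0.memTm (f : E → M.N) (g : E → M.S) [hf : Tm M f] [hg : SV M g] :
    S0 M (fun e => M.mem (f e) (g e)) := by
  obtain ⟨t, ht⟩ := hf
  obtain ⟨s, hs⟩ := hg
  exact ⟨.mem t s, .mem _ _, fun e => by rw [sat_mem, ht, hs]⟩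

theorem S0.allLeTm (f : E → M.N) (P : E → M.N → Prop) [hf : Tm M f]
    [hP : S0 M (fun q : E × M.N => P q.1 q.2)] : S0 M (fun e => ∀ x, x ≤ f e → P e x) := by
  obtain ⟨t, ht⟩ := hf
  obtain ⟨φ, h₀, hφ⟩ := hP
  refine ⟨.allLe t φ, .allLe _ h₀, fun e => ?_⟩
  rw [sat_allLe, ht]
  exact forall_congr' fun x => imp_congr_right fun _ => hφ (e, x)

theorem S0.exLeTm (f : E → M.N) (P : E → M.N → Prop) [hf : Tm M f]
    [hP : S0 M (fun q : E × M.N => P q.1 q.2)] : S0 M (fun e => ∃ x, x ≤ f e ∧ P e x) := by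
  obtain ⟨t, ht⟩ := hf
  obtain ⟨φ, h₀, hφ⟩ := hP
  refine ⟨.exLe t φ, .exLe _ h₀, fun e => ?_⟩
  rw [sat_exLe, ht]
  exact exists_congr fun x => and_congr_right fun _ => hφ (e, x)

end Instances

/-- `P` is definable by an existential bounded formula. -/
class S1 (M : Model V1) {E : Type} [Ctx M E] (P : E → Prop) : Prop where
  out : ∃ φ, IsSigma1 φ ∧ ∀ e, Sat M.toStr (Ctx.nv e) (Ctx.sv e) φ ↔ P e

instance S1.exS {E : Type} [Ctx M E] (f : E → M.N) (P : E → M.S → Prop) [hf : Tm M f]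
    [hP : S0 M (fun q : E × M.S => P q.1 q.2)] :
    S1 M (fun e => ∃ X, M.len X ≤ f e ∧ P e X) := by
  obtain ⟨t, ht⟩ := hf
  obtain ⟨φ, h₀, hφ⟩ := hP
  refine ⟨.exSLe t φ, .exSLe _ (.sigma0 h₀), fun e => ?_⟩
  rw [sat_exSLe, ht]
  exact exists_congr fun x => and_congr_right fun _ => hφ (e, x)

/-! ### Induction and comprehension in models of `V1` -/

theorem sat_indAxiom {M : Str} {v : ℕ → M.N} {w : ℕ → M.S} {φ : Formula}
    (h : Sat M v w (indAxiom φ)) (h₀ : Sat M (scons 0 v) w φ)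
    (h₁ : ∀ x, Sat M (scons x v) w φ → Sat M (scons (x + 1) v) w φ) (x : M.N) :
    Sat M (scons x v) w φ := by
  simp only [indAxiom, sat_imp, sat_and, sat_allN, Formula.instN, Formula.instSucc, sat_subst,
    comp_scons, id] at h
  exact h ⟨h₀, h₁⟩ x

theorem Model.ind {P : M.N → Prop} (hP : S0 M (fun q : Bool × M.N => P q.2)) (h₀ : P 0)
    (h₁ : ∀ x, P x → P (x + 1)) (x : M.N) : P x := by
  obtain ⟨φ, h, hφ⟩ := hP
  have := M.sat_ax _ (.inl (.inl (.inr ⟨φ, h, rfl⟩))) M.nvar M.svar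
  exact (hφ (true, x)).1 (sat_indAxiom this ((hφ (true, 0)).2 h₀)
    (fun x hx => (hφ (true, x + 1)).2 (h₁ x ((hφ (true, x)).1 hx))) x)

theorem Model.ind₁ {P : M.N → Prop} (hP : S1 M (fun q : Bool × M.N => P q.2)) (h₀ : P 0)
    (h₁ : ∀ x, P x → P (x + 1)) (x : M.N) : P x := by
  obtain ⟨φ, h, hφ⟩ := hP
  have := M.sat_ax _ (.inr ⟨φ, h, rfl⟩) M.nvar M.svar
  exact (hφ (true, x)).1 (sat_indAxiom this ((hφ (true, 0)).2 h₀)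
    (fun x hx => (hφ (true, x + 1)).2 (h₁ x ((hφ (true, x)).1 hx))) x)

theorem Model.comp (P : M.N → Prop) [hP : S0 M (fun q : Bool × M.N => P q.2)] (b : M.N) :
    ∃ X, M.len X ≤ b ∧ ∀ y, y < b → (M.mem y X ↔ P y) := by
  -- In `compAxiom` the length bound is a further number variable of the formula, so `P` is weakened
  -- by a variable on which it does not depend.
  have := Pr.lift (M := M) (fun e : Bool × M.N => e.1)
  have := S0.comp (M := M) (fun e : (Bool × M.N) × M.N => (e.1.1, e.2)) (fun q => P q.2)
  obtain ⟨φ, h, hφ⟩ := this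
  have := M.sat_ax _ (.inl (.inr ⟨φ, h, rfl⟩)) M.nvar M.svar
  simp only [compAxiom, sat_allN, sat_exSLe, sat_allLt, sat_iff, sat_mem, Formula.shiftS,
    sat_subst, eval_var, scons_zero] at this
  obtain ⟨X, h₁, h₂⟩ := this b
  exact ⟨X, h₁, fun y hy => (h₂ y hy).trans (hφ ((true, b), y))⟩

/-! ### Arithmetic in models of `V1` -/

namespace Model

variable {M : Model V1}

theorem basic {φ : Formula} (h : TwoBasic φ) (v : ℕ → M.N) (w : ℕ → M.S) : Sat M.toStr v w φ :=
  M.sat_ax _ (.inl (.inl (.inl h))) v w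

theorem succ_ne_zero (x : M.N) : x + 1 ≠ 0 := by
  simpa using basic .b1 (fun _ => x) M.svar

theorem succ_cancel {x y : M.N} (h : x + 1 = y + 1) : x = y := by
  have := basic .b2 (scons x (fun _ => y)) M.svar
  simp only [sat_imp, sat_eqN, eval_add, eval_var, eval_one, scons_zero, scons_one] at this
  exact this h

theorem add_zero' (x : M.N) : x + 0 = x := by
  simpa using basic .b3 (fun _ => x) M.svar

theorem add_succ' (x y : M.N) : x + (y + 1) = x + y + 1 := by
  simpa using basic .b4 (scons x (fun _ => y)) M.svar

theorem mul_zero' (x : M.N) : x * 0 = 0 := by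
  simpa using basic .b5 (fun _ => x) M.svar

theorem mul_succ' (x y : M.N) : x * (y + 1) = x * y + x := by
  simpa using basic .b6 (scons x (fun _ => y)) M.svar

theorem le_antisymm' {x y : M.N} (h : x ≤ y) (h' : y ≤ x) : x = y := by
  have := basic .b7 (scons x (fun _ => y)) M.svar
  simp only [sat_imp, sat_and, sat_le, sat_eqN, eval_var, scons_zero, scons_one] at this
  exact this ⟨h, h'⟩

theorem le_add (x y : M.N) : x ≤ x + y := by
  simpa using basic .b8 (scons x (fun _ => y)) M.svar

theorem zero_le' (x : M.N) : 0 ≤ x := by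
  simpa using basic .b9 (fun _ => x) M.svar

theorem le_total' (x y : M.N) : x ≤ y ∨ y ≤ x := by
  simpa using basic .b10 (scons x (fun _ => y)) M.svar

theorem le_iff_lt_succ (x y : M.N) : x ≤ y ↔ x < y + 1 := by
  simpa using basic .b11 (scons x (fun _ => y)) M.svar

theorem exists_pred {x : M.N} (h : x ≠ 0) : ∃ y, y + 1 = x := by
  have := basic .b12 (fun _ => x) M.svar
  simp only [sat_imp, sat_neg, sat_eqN, eval_var, eval_zero, sat_exLe, scons_zero, scons_one,
    eval_add, eval_one] at this
  obtain ⟨y, _, hy⟩ := this h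
  exact ⟨y, hy⟩

theorem lt_len {x : M.N} {X : M.S} (h : M.mem x X) : x < M.len X := by
  have := basic .l1 (fun _ => x) (fun _ => X)
  simp only [sat_imp, sat_mem, eval_var, sat_lt, eval_len] at this
  exact this h

section Semiring

attribute [local instance] S0.eqTm S0.leTm S0.exLeTm

theorem add_assoc' (a b c : M.N) : a + b + c = a + (b + c) := by
  induction c using Model.ind with
  | hP => infer_instance
  | h₀ => rw [add_zero', add_zero']
  | h₁ x ih => rw [add_succ', add_succ', add_succ', ih]

theorem zero_add' (a : M.N) : 0 + a = a := by
  induction a using Model.ind with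
  | hP => infer_instance
  | h₀ => rw [add_zero']
  | h₁ x ih => rw [add_succ', ih]

theorem succ_add' (a b : M.N) : a + 1 + b = a + b + 1 := by
  induction b using Model.ind with
  | hP => infer_instance
  | h₀ => rw [add_zero', add_zero']
  | h₁ x ih => rw [add_succ', add_succ', ih]

theorem add_comm' (a b : M.N) : a + b = b + a := by
  induction b using Model.ind with
  | hP => infer_instance
  | h₀ => rw [add_zero', zero_add']
  | h₁ x ih => rw [add_succ', succ_add', ih]

theorem mul_add' (a b c : M.N) : a * (b + c) = a * b + a * c := by
  induction c using Model.ind with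
  | hP => infer_instance
  | h₀ => rw [mul_zero', add_zero', add_zero']
  | h₁ x ih => rw [add_succ', mul_succ', mul_succ', ih, add_assoc']

theorem mul_assoc' (a b c : M.N) : a * b * c = a * (b * c) := by
  induction c using Model.ind with
  | hP => infer_instance
  | h₀ => rw [mul_zero', mul_zero', mul_zero']
  | h₁ x ih => rw [mul_succ', mul_succ', mul_add', ih]

theorem zero_mul' (a : M.N) : 0 * a = 0 := by
  induction a using Model.ind with
  | hP => infer_instance
  | h₀ => rw [mul_zero']
  | h₁ x ih => rw [mul_succ', ih, add_zero']

theorem succ_mul' (a b : M.N) : (a + 1) * b = a * b + b := by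
  induction b using Model.ind with
  | hP => infer_instance
  | h₀ => rw [mul_zero', mul_zero', add_zero']
  | h₁ x ih =>
    rw [mul_succ', mul_succ', ih, add_assoc', add_assoc', add_succ', add_succ', add_comm' x a,
      add_assoc', add_assoc']

theorem mul_comm' (a b : M.N) : a * b = b * a := by
  induction b using Model.ind with
  | hP => infer_instance
  | h₀ => rw [mul_zero', zero_mul']
  | h₁ x ih => rw [mul_succ', succ_mul', ih]

theorem one_mul' (a : M.N) : 1 * a = a := by
  rw [← zero_add' (1 : M.N), succ_mul', zero_mul', zero_add']

theorem add_right_cancel' {a b c : M.N} (h : a + c = b + c) : a = b := by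
  induction c using Model.ind with
  | hP => infer_instance
  | h₀ => rwa [add_zero', add_zero'] at h
  | h₁ x ih => exact ih (succ_cancel (by rwa [add_succ', add_succ'] at h))

instance : CommSemiring M.N where
  add_assoc := add_assoc'
  zero_add := zero_add'
  add_zero := add_zero'
  add_comm := add_comm'
  left_distrib := mul_add'
  right_distrib a b c := by rw [mul_comm', mul_add', mul_comm' c, mul_comm' c]
  zero_mul := zero_mul'
  mul_zero := mul_zero'
  mul_assoc := mul_assoc'
  one_mul := one_mul'
  mul_one a := by rw [mul_comm', one_mul']
  mul_comm := mul_comm'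
  nsmul := nsmulRec
  npow := npowRec

theorem exists_add_of_le {x y : M.N} (h : x ≤ y) : ∃ z, y = x + z := by
  -- The difference is bounded by `y` to keep the induction formula Σ₀.
  have key : x ≤ y → ∃ z, z ≤ y ∧ y = x + z := by
    clear h
    induction y using Model.ind with
    | hP => infer_instance
    | h₀ =>
      intro h
      exact ⟨0, zero_le' _, by rw [add_zero, le_antisymm' h (zero_le' x)]⟩
    | h₁ y ih =>
      intro h
      by_cases h₁ : x = y + 1
      · exact ⟨0, zero_le' _, by rw [add_zero, h₁]⟩
      · obtain ⟨z, _, rfl⟩ := ih ((le_iff_lt_succ _ _).2 ⟨h, h₁⟩)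
        exact ⟨z + 1, by rw [add_assoc, add_comm x]; exact le_add _ _, by rw [add_assoc]⟩
  obtain ⟨z, _, hz⟩ := key h
  exact ⟨z, hz⟩

theorem le_trans' {x y z : M.N} (h : x ≤ y) (h' : y ≤ z) : x ≤ z := by
  obtain ⟨a, rfl⟩ := exists_add_of_le h
  obtain ⟨b, rfl⟩ := exists_add_of_le h'
  rw [add_assoc]
  exact le_add _ _

theorem le_refl' (x : M.N) : x ≤ x := by
  simpa using le_add x 0

end Semiring

noncomputable instance : LinearOrder M.N where
  le_refl := le_refl'
  le_trans _ _ _ := le_trans'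
  le_antisymm _ _ := le_antisymm'
  lt_iff_le_not_ge x y := ⟨fun h => ⟨h.1, fun h' => h.2 (le_antisymm' h.1 h')⟩,
    fun h => ⟨h.1, fun e => h.2 (e ▸ le_refl' _)⟩⟩
  le_total := le_total'
  toDecidableLE := Classical.decRel _

theorem lt_succ_iff {x y : M.N} : x < y + 1 ↔ x ≤ y := (le_iff_lt_succ x y).symm

theorem zero_lt_succ (x : M.N) : 0 < x + 1 := lt_succ_iff.2 (zero_le' x)

theorem succ_le_iff {x y : M.N} : x + 1 ≤ y ↔ x < y := by
  constructor
  · exact fun h => lt_of_lt_of_le (lt_succ_iff.2 le_rfl) h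
  · intro h
    obtain ⟨z, rfl⟩ := exists_add_of_le h.le
    have hz : z ≠ 0 := by rintro rfl; simp at h
    obtain ⟨z, rfl⟩ := exists_pred hz
    rw [add_comm z, ← add_assoc]
    exact le_add _ _

instance : IsStrictOrderedRing M.N := by
  have : IsCancelAdd M.N := by
    have : IsRightCancelAdd M.N := ⟨fun a b c h => add_right_cancel' h⟩
    exact AddCommMagma.IsRightCancelAdd.toIsCancelAdd _
  have hadd : ∀ a b : M.N, a ≤ b → ∀ c, c + a ≤ c + b := by
    intro a b h c
    obtain ⟨z, rfl⟩ := exists_add_of_le h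
    rw [← add_assoc]
    exact le_add _ _
  have : IsOrderedAddMonoid M.N := 
    ⟨fun a b h c => by rw [add_comm a, add_comm b]; exact hadd a b h c, fun a b h c => hadd a b h c⟩
  have hmul : ∀ a b : M.N, a < b → ∀ c, 0 < c → c * a < c * b := by
    intro a b h c hc
    obtain ⟨z, rfl⟩ := exists_add_of_le (succ_le_iff.2 h)
    obtain ⟨c, rfl⟩ := exists_pred hc.ne'
    rw [← succ_le_iff]
    obtain ⟨d, hd⟩ : ∃ d, (c + 1) * (a + 1 + z) = (c + 1) * a + 1 + d := ⟨c + (c + 1) * z, by ring⟩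
    rw [hd]
    exact le_add _ _
  exact
    { le_of_add_le_add_left := fun a b c h => by
        by_contra h'
        have h₁ := hadd _ _ (not_le.1 h').le a
        exact (not_le.1 h').ne (add_left_cancel (le_antisymm h₁ h))
      zero_le_one := zero_le' _
      exists_pair_ne := ⟨0, 1, fun h => succ_ne_zero 0 (by rw [zero_add]; exact h.symm)⟩
      mul_lt_mul_of_pos_left := fun c hc a b h => hmul a b h c hc
      mul_lt_mul_of_pos_right := fun c hc a b h => by
        show a * c < b * c
        rw [mul_comm a, mul_comm b]; exact hmul a b h c hc }

instance : CanonicallyOrderedAdd M.N where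
  exists_add_of_le h := exists_add_of_le h
  le_self_add := le_add
  le_add_self a b := by rw [add_comm]; exact le_add _ _

/-- The least number principle follows from ordinary induction on `x` for the bounded statement that
`P` fails at all `y ≤ x`. -/
theorem exists_least {P : M.N → Prop} (hP : S0 M (fun q : Bool × M.N => P q.2))
    (h : ∃ x, P x) : ∃ x, P x ∧ ∀ y, y < x → ¬ P y := by
  by_contra! hc
  obtain ⟨x, hx⟩ := h
  have key : ∀ y, y ≤ x → ¬ P y := by
    clear hx
    induction x using Model.ind with
    | hP =>
      have := Pr.lift (M := M) (fun e : Bool × M.N => e.1)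
      have := S0.comp (M := M) (fun e : (Bool × M.N) × M.N => (e.1.1, e.2)) (fun q => P q.2)
      exact S0.allLeTm _ (fun _ y => ¬ P y)
    | h₀ =>
      intro y hy h
      obtain ⟨z, hz, _⟩ := hc y h
      exact (hz.trans_le hy).not_ge (zero_le' z)
    | h₁ x ih =>
      intro y hy h
      obtain ⟨z, hz, h'⟩ := hc y h
      exact ih z (lt_succ_iff.1 (hz.trans_le hy)) h'
  exact key x le_rfl hx

end Model

/-! ### The ring of differences of an ordered semiring -/

section Differences

variable (R : Type) [CommSemiring R] [LinearOrder R] [IsStrictOrderedRing R]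

/-- Equality of formal differences. -/
def diffSetoid : Setoid (R × R) where
  r x y := x.1 + y.2 = y.1 + x.2
  iseqv := ⟨fun _ => rfl, fun h => h.symm, fun {x y z} h h' => by
    refine add_right_cancel (b := y.1 + y.2) ?_
    linear_combination h + h'⟩

/-- The ring of differences. -/
def Diff : Type := Quotient (diffSetoid R)

variable {R}

namespace Diff

def mk (x y : R) : Diff R := Quotient.mk (diffSetoid R) (x, y)

theorem mk_eq {x y x' y' : R} : mk x y = mk x' y' ↔ x + y' = x' + y := Quotient.eq (r := diffSetoid R)

theorem ind' {P : Diff R → Prop} (h : ∀ x y, P (mk x y)) (a : Diff R) : P a :=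
  Quotient.ind (fun p => h p.1 p.2) a

instance : Zero (Diff R) := ⟨mk 0 0⟩
instance : One (Diff R) := ⟨mk 1 0⟩
instance : Add (Diff R) := ⟨Quotient.map₂ (fun x y => (x.1 + y.1, x.2 + y.2)) (by
  intro x x' (h : _ = _) y y' (h' : _ = _)
  show _ = _
  linear_combination h + h')⟩
instance : Neg (Diff R) := ⟨Quotient.map (fun x => (x.2, x.1)) (by
  intro x x' (h : _ = _)
  show _ = _
  linear_combination h.symm)⟩
instance : Mul (Diff R) := ⟨Quotient.map₂ (fun x y => (x.1 * y.1 + x.2 * y.2, x.1 * y.2 + x.2 * y.1)) (by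
  intro x x' (h : _ = _) y y' (h' : _ = _)
  show _ = _
  simp only
  -- The representatives are exchanged one factor at a time. Without subtraction, the two components
  -- of the intermediate product of `x'` and `y` are added on both sides and cancelled.
  refine add_right_cancel (b := x'.1 * y.1 + x'.2 * y.2 + x'.1 * y.2 + x'.2 * y.1) ?_
  linear_combination y.1 * h + y.2 * h.symm + x'.1 * h' + x'.2 * h'.symm)⟩

theorem mk_add (x y x' y' : R) : mk x y + mk x' y' = mk (x + x') (y + y') := rfl
theorem mk_mul (x y x' y' : R) : mk x y * mk x' y' = mk (x * x' + y * y') (x * y' + y * x') := rfl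
theorem neg_mk (x y : R) : -mk x y = mk y x := rfl
theorem zero_def : (0 : Diff R) = mk 0 0 := rfl
theorem one_def : (1 : Diff R) = mk 1 0 := rfl

instance : CommRing (Diff R) where
  add_assoc a b c := by
    induction a using ind'; induction b using ind'; induction c using ind'
    simp only [mk_add, mk_eq]; ring
  zero_add a := by induction a using ind'; simp only [zero_def, mk_add, mk_eq]; ring
  add_zero a := by induction a using ind'; simp only [zero_def, mk_add, mk_eq]; ring
  add_comm a b := by
    induction a using ind'; induction b using ind'
    simp only [mk_add, mk_eq]; ring
  left_distrib a b c := by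
    induction a using ind'; induction b using ind'; induction c using ind'
    simp only [mk_add, mk_mul, mk_eq]; ring
  right_distrib a b c := by
    induction a using ind'; induction b using ind'; induction c using ind'
    simp only [mk_add, mk_mul, mk_eq]; ring
  zero_mul a := by induction a using ind'; simp only [zero_def, mk_mul, mk_eq]; ring
  mul_zero a := by induction a using ind'; simp only [zero_def, mk_mul, mk_eq]; ring
  mul_assoc a b c := by
    induction a using ind'; induction b using ind'; induction c using ind'
    simp only [mk_mul, mk_eq]; ring
  one_mul a := by induction a using ind'; simp only [one_def, mk_mul, mk_eq]; ring
  mul_one a := by induction a using ind'; simp only [one_def, mk_mul, mk_eq]; ring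
  neg_add_cancel a := by
    induction a using ind'; simp only [zero_def, mk_add, neg_mk, mk_eq]; ring
  mul_comm a b := by
    induction a using ind'; induction b using ind'
    simp only [mk_mul, mk_eq]; ring
  nsmul := nsmulRec
  zsmul := zsmulRec

instance : LE (Diff R) := ⟨Quotient.lift₂ (fun x y => x.1 + y.2 ≤ y.1 + x.2) (by
  intro x y x' y' (h : _ = _) (h' : _ = _)
  refine propext ?_
  rw [← add_le_add_iff_right (y'.2 + x'.2)]
  rw [show x.1 + y.2 + (y'.2 + x'.2) = x'.1 + y'.2 + (y.2 + x.2) by linear_combination h,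
    show y.1 + x.2 + (y'.2 + x'.2) = y'.1 + x'.2 + (y.2 + x.2) by linear_combination h',
    add_le_add_iff_right])⟩

theorem mk_le {x y x' y' : R} : mk x y ≤ mk x' y' ↔ x + y' ≤ x' + y := Iff.rfl

noncomputable instance : LinearOrder (Diff R) where
  le_refl a := by induction a using ind'; exact mk_le.2 le_rfl
  le_trans a b c h h' := by
    induction a using ind'; induction b using ind'; rename_i x y
    induction c using ind'
    rw [mk_le] at *
    rw [← add_le_add_iff_right (x + y)]
    calc _ = _ := by ring
      _ ≤ _ := add_le_add h h'
      _ = _ := by ring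
  le_antisymm a b h h' := by
    induction a using ind'; induction b using ind'
    exact mk_eq.2 (le_antisymm h h')
  le_total a b := by
    induction a using ind'; induction b using ind'
    exact le_total _ _
  toDecidableLE := Classical.decRel _

instance [ExistsAddOfLE R] : IsStrictOrderedRing (Diff R) := by
  have hadd : ∀ a b : Diff R, a ≤ b → ∀ c, c + a ≤ c + b := fun a b h c => by
    induction a using ind'; induction b using ind'; induction c using ind'
    simp only [mk_add, mk_le] at *
    rename_i x y x' y' z w
    calc z + x + (w + y') = x + y' + (z + w) := by ring
      _ ≤ x' + y + (z + w) := by gcongr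
      _ = _ := by ring
  have : IsOrderedAddMonoid (Diff R) := ⟨fun a b h c => by
    rw [add_comm a, add_comm b]; exact hadd a b h c, fun a b h c => hadd a b h c⟩
  have : ZeroLEOneClass (Diff R) := ⟨mk_le.2 (by simp)⟩
  have : Nontrivial (Diff R) := ⟨0, 1, fun h => by
    simp [zero_def, one_def, mk_eq] at h⟩
  refine IsStrictOrderedRing.of_mul_pos fun a b h h' => ?_
  induction a using ind'; induction b using ind'
  rw [← not_le] at *
  simp only [mk_mul, zero_def, mk_le, not_le, add_zero, zero_add] at *
  rw [add_comm (_ * _) (_ * _)]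
  calc _ < _ := mul_add_mul_lt_mul_add_mul h h'
    _ = _ := add_comm _ _

/-- The embedding of the semiring into its ring of differences. -/
def of : R →+* Diff R where
  toFun x := mk x 0
  map_zero' := rfl
  map_one' := rfl
  map_add' x y := by simp [mk_add]
  map_mul' x y := by simp [mk_mul]

theorem of_le {x y : R} : of x ≤ of y ↔ x ≤ y := by
  show mk _ _ ≤ mk _ _ ↔ _
  simp [mk_le]

theorem of_inj {x y : R} : of x = of y ↔ x = y := by
  show mk _ _ = mk _ _ ↔ _
  simp [mk_eq]

end Diff

end Differences

namespace Model

variable {M : Model V1}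

/-- Facts about numbers of the model are moved to an ordered commutative ring, where `linarith` and
`nlinarith` apply. -/
theorem zle {x y : M.N} : x ≤ y ↔ Diff.of x ≤ Diff.of y := Diff.of_le.symm

/-- Discreteness is built into the translation: a strict inequality becomes a gap of at least one,
which arithmetic in an ordered ring alone would not see. -/
theorem zlt {x y : M.N} : x < y ↔ Diff.of x + 1 ≤ Diff.of y := by
  rw [← succ_le_iff, zle, map_add, map_one]

theorem zeq {x y : M.N} : x = y ↔ Diff.of x = Diff.of y := Diff.of_inj.symm

theorem zpos (x : M.N) : 0 ≤ Diff.of x := by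
  rw [← map_zero Diff.of, Diff.of_le]; exact zero_le' x

end Model

/-! ### Definable functions -/

variable {M : Model V1}

/-- `f` is bounded by a term and has a graph that is definable by a bounded formula without set
quantifiers. -/
class F0 (M : Model V1) {E : Type} [Ctx M E] (f : E → M.N) : Prop where
  graph : S0 M (fun q : E × M.N => q.2 = f q.1)
  bound : ∃ b : E → M.N, Tm M b ∧ ∀ e, f e ≤ b e

section Instances

variable {E F : Type} [Ctx M E] [Ctx M F]

theorem F0.ofTm (f : E → M.N) [hf : Tm M f] : F0 M f := by
  have := Tm.comp (M := M) (fun q : E × M.N => q.1) f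
  exact ⟨S0.eqTm (fun q : E × M.N => q.2) (fun q => f q.1), f, hf, fun _ => le_rfl⟩

theorem F0.comp (π : E → F) [h : Pr M π] (f : F → M.N) [hf : F0 M f] :
    F0 M (fun e => f (π e)) := by
  obtain ⟨hg, b, hb, hle⟩ := hf
  have := Pr.lift (M := M) π
  exact ⟨S0.comp (fun q : E × M.N => (π q.1, q.2)) (fun q : F × M.N => q.2 = f q.1),
    fun e => b (π e), Tm.comp π b, fun e => hle _⟩

/-- Substitution of a definable function. -/
theorem S0.subst (f : E → M.N) (P : E → M.N → Prop) [hf : F0 M f]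
    [hP : S0 M (fun q : E × M.N => P q.1 q.2)] : S0 M (fun e => P e (f e)) := by
  obtain ⟨hg, b, hb, hle⟩ := hf
  have := S0.exLeTm b (fun e x => x = f e ∧ P e x)
  exact S0.congr (P := fun e => ∃ x, x ≤ b e ∧ x = f e ∧ P e x)
    fun e => ⟨fun ⟨x, _, h, h'⟩ => h ▸ h', fun h => ⟨_, hle e, rfl, h⟩⟩

instance F0.const (c : M.N) : F0 M (fun _ : E => c) := F0.ofTm _

instance F0.snd (π : E → F × M.N) [h : Pr M π] : F0 M (fun e => (π e).2) := F0.ofTm _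

instance S0.eq (f g : E → M.N) [hf : F0 M f] [hg : F0 M g] : S0 M (fun e => f e = g e) := by
  have := hg.graph
  exact S0.subst f (fun e x => x = g e)

instance S0.le (f g : E → M.N) [hf : F0 M f] [hg : F0 M g] : S0 M (fun e => f e ≤ g e) := by
  have := F0.comp (M := M) (fun q : E × M.N => q.1) g
  have := S0.leTm (M := M) (fun q : (E × M.N) × M.N => q.1.2) (fun q => q.2)
  have : S0 M (fun q : E × M.N => q.2 ≤ g q.1) :=
    S0.subst (fun q : E × M.N => g q.1) (fun q x => q.2 ≤ x)
  exact S0.subst f (fun e x => x ≤ g e)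

instance S0.lt (f g : E → M.N) [hf : F0 M f] [hg : F0 M g] : S0 M (fun e => f e < g e) :=
  S0.congr (P := fun e => f e ≤ g e ∧ f e ≠ g e) fun _ => lt_iff_le_and_ne.symm

instance S0.ne (f g : E → M.N) [hf : F0 M f] [hg : F0 M g] : S0 M (fun e => f e ≠ g e) :=
  S0.not _

instance S0.mem (f : E → M.N) (g : E → M.S) [hf : F0 M f] [hg : SV M g] :
    S0 M (fun e => M.mem (f e) (g e)) := by
  obtain ⟨i, hi⟩ := hg
  have : SV M (fun q : E × M.N => g q.1) := ⟨i, fun q => hi q.1⟩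
  have := S0.memTm (M := M) (fun q : E × M.N => q.2) (fun q => g q.1)
  exact S0.subst f (fun e x => M.mem x (g e))

instance S0.allLe (f : E → M.N) (P : E → M.N → Prop) [hf : F0 M f]
    [hP : S0 M (fun q : E × M.N => P q.1 q.2)] : S0 M (fun e => ∀ x, x ≤ f e → P e x) := by
  have := F0.comp (M := M) (fun q : E × M.N => q.1) f
  obtain ⟨hg, b, hb, hle⟩ := hf
  have := S0.allLeTm b (fun e x => x ≤ f e → P e x)
  exact S0.congr (P := fun e => ∀ x, x ≤ b e → x ≤ f e → P e x)
    fun e => ⟨fun h x hx => h x (hx.trans (hle e)) hx, fun h x _ => h x⟩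

instance S0.allLt (f : E → M.N) (P : E → M.N → Prop) [hf : F0 M f]
    [hP : S0 M (fun q : E × M.N => P q.1 q.2)] : S0 M (fun e => ∀ x, x < f e → P e x) := by
  have := F0.comp (M := M) (fun q : E × M.N => q.1) f
  have := S0.allLe f (fun e x => x < f e → P e x)
  exact S0.congr (P := fun e => ∀ x, x ≤ f e → x < f e → P e x)
    fun e => ⟨fun h x hx => h x hx.le hx, fun h x _ => h x⟩

instance S0.exLe (f : E → M.N) (P : E → M.N → Prop) [hf : F0 M f]
    [hP : S0 M (fun q : E × M.N => P q.1 q.2)] : S0 M (fun e => ∃ x, x ≤ f e ∧ P e x) :=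
  S0.congr (P := fun e => ¬ ∀ x, x ≤ f e → ¬ P e x) fun e => by simp

instance S0.exLt (f : E → M.N) (P : E → M.N → Prop) [hf : F0 M f]
    [hP : S0 M (fun q : E × M.N => P q.1 q.2)] : S0 M (fun e => ∃ x, x < f e ∧ P e x) :=
  S0.congr (P := fun e => ¬ ∀ x, x < f e → ¬ P e x) fun e => by simp

instance F0.add (f g : E → M.N) [hf : F0 M f] [hg : F0 M g] : F0 M (fun e => f e + g e) := by
  have := F0.comp (M := M) (fun q : E × M.N => q.1) f
  have := F0.comp (M := M) (fun q : (E × M.N) × M.N => q.1.1) g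
  have := F0.ofTm (M := M) (fun q : ((E × M.N) × M.N) × M.N => q.1.2 + q.2)
  have : S0 M (fun q : (E × M.N) × M.N => q.1.2 = q.2 + g q.1.1) :=
    S0.subst (fun q : (E × M.N) × M.N => g q.1.1)
      (fun (q : (E × M.N) × M.N) x => q.1.2 = q.2 + x)
  obtain ⟨_, b, hb, hle⟩ := hf
  obtain ⟨_, c, hc, hle'⟩ := hg
  exact ⟨S0.subst (fun q : E × M.N => f q.1) (fun (q : E × M.N) x => q.2 = x + g q.1),
    fun e => b e + c e, inferInstance, fun e => add_le_add (hle e) (hle' e)⟩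

instance F0.mul (f g : E → M.N) [hf : F0 M f] [hg : F0 M g] : F0 M (fun e => f e * g e) := by
  have := F0.comp (M := M) (fun q : E × M.N => q.1) f
  have := F0.comp (M := M) (fun q : (E × M.N) × M.N => q.1.1) g
  have := F0.ofTm (M := M) (fun q : ((E × M.N) × M.N) × M.N => q.1.2 * q.2)
  have : S0 M (fun q : (E × M.N) × M.N => q.1.2 = q.2 * g q.1.1) :=
    S0.subst (fun q : (E × M.N) × M.N => g q.1.1)
      (fun (q : (E × M.N) × M.N) x => q.1.2 = q.2 * x)
  obtain ⟨_, b, hb, hle⟩ := hf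
  obtain ⟨_, c, hc, hle'⟩ := hg
  exact ⟨S0.subst (fun q : E × M.N => f q.1) (fun (q : E × M.N) x => q.2 = x * g q.1),
    fun e => b e * c e, inferInstance,
    fun e => mul_le_mul (hle e) (hle' e) (Model.zero_le' _) (Model.zero_le' _)⟩

instance F0.ite (P : E → Prop) (f g : E → M.N) {_ : ∀ e, Decidable (P e)} [hP : S0 M P]
    [hf : F0 M f] [hg : F0 M g] : F0 M (fun e => if P e then f e else g e) := by
  have := F0.comp (M := M) (fun q : E × M.N => q.1) f
  have := F0.comp (M := M) (fun q : E × M.N => q.1) g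
  have := S0.comp (M := M) (fun q : E × M.N => q.1) P
  obtain ⟨_, b, hb, hle⟩ := hf
  obtain ⟨_, c, hc, hle'⟩ := hg
  refine ⟨S0.congr (P := fun q : E × M.N => P q.1 ∧ q.2 = f q.1 ∨ ¬ P q.1 ∧ q.2 = g q.1)
    fun q => ?_, fun e => b e + c e, inferInstance, fun e => ?_⟩
  · split_ifs with h <;> simp [h]
  · dsimp only
    split_ifs
    · exact (hle e).trans (Model.le_add _ _)
    · rw [add_comm]; exact (hle' e).trans (Model.le_add _ _)

end Instances

namespace Model

-- Bounded minimization.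

open Classical in
/-- The least `x < b` with `P x`, or `0`. -/
noncomputable def mu (b : M.N) (P : M.N → Prop) : M.N :=
  if h : ∃ x, x < b ∧ P x ∧ ∀ y, y < x → ¬ P y then h.choose else 0

/-- Since leastness is part of the definition, this description of the graph holds for every `P`,
and it is Σ₀ as soon as `P` is. The least number principle enters only in `mu_spec`. -/
theorem eq_mu_iff {b : M.N} {P : M.N → Prop} {z : M.N} :
    z = mu b P ↔ (z < b ∧ P z ∧ ∀ y, y < z → ¬ P y) ∨
      (z = 0 ∧ ¬ ∃ x, x < b ∧ P x ∧ ∀ y, y < x → ¬ P y) := by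
  unfold mu
  split_ifs with h
  · constructor
    · rintro rfl
      exact .inl h.choose_spec
    · rintro (h' | h')
      · refine le_antisymm ?_ ?_
        · by_contra h₁
          exact h'.2.2 _ (not_le.1 h₁) h.choose_spec.2.1
        · by_contra h₁
          exact h.choose_spec.2.2 _ (not_le.1 h₁) h'.2.1
      · exact (h'.2 h).elim
  · constructor
    · exact fun h' => .inr ⟨h', h⟩
    · rintro (h' | h')
      · exact (h ⟨z, h'⟩).elim
      · exact h'.1

theorem mu_eq {b : M.N} {P : M.N → Prop} {z : M.N} (h : z < b) (hz : P z)
    (hu : ∀ y, y < z → ¬ P y) : mu b P = z :=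
  (eq_mu_iff.2 (.inl ⟨h, hz, hu⟩)).symm

theorem mu_le (b : M.N) (P : M.N → Prop) : mu b P ≤ b := by
  rcases eq_mu_iff.1 (rfl : mu b P = mu b P) with h | h
  · exact h.1.le
  · rw [h.1]; exact zero_le' _

theorem mu_lt {b : M.N} (hb : 0 < b) (P : M.N → Prop) : mu b P < b := by
  rcases eq_mu_iff.1 (rfl : mu b P = mu b P) with h | h
  · exact h.1
  · rw [h.1]; exact hb

theorem mu_spec {b : M.N} {P : M.N → Prop} (hP : S0 M (fun q : Bool × M.N => P q.2))
    (h : ∃ x, x < b ∧ P x) : mu b P < b ∧ P (mu b P) := by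
  rcases eq_mu_iff.1 (rfl : mu b P = mu b P) with h' | h'
  · exact ⟨h'.1, h'.2.1⟩
  · obtain ⟨x, hx, hPx⟩ := h
    obtain ⟨z, hz, hmin⟩ := exists_least hP ⟨x, hPx⟩
    exact (h'.2 ⟨z, (not_lt.1 fun h₁ => hmin x h₁ hPx).trans_lt hx, hz, hmin⟩).elim

end Model

open Model

instance F0.mu {E : Type} [Ctx M E] (f : E → M.N) (P : E → M.N → Prop) [hf : F0 M f]
    [hP : S0 M (fun q : E × M.N => P q.1 q.2)] : F0 M (fun e => Model.mu (f e) (P e)) := by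
  have h₁ := F0.comp (M := M) (fun q : E × M.N => q.1) f
  have h₂ : S0 M (fun q : (E × M.N) × M.N => P q.1.1 q.2) := by
    have := Pr.lift (M := M) (fun q : E × M.N => q.1)
    exact S0.comp (fun q : (E × M.N) × M.N => (q.1.1, q.2)) (fun q => P q.1 q.2)
  have h₃ : S0 M (fun q : ((E × M.N) × M.N) × M.N => P q.1.1.1 q.2) := by
    have := Pr.lift (M := M) (fun q : (E × M.N) × M.N => q.1)
    exact S0.comp (fun q : ((E × M.N) × M.N) × M.N => (q.1.1, q.2)) (fun q => P q.1.1 q.2)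
  obtain ⟨_, b, hb, hle⟩ := hf
  refine ⟨S0.congr (fun q => eq_mu_iff.symm), b, hb, fun e => (mu_le _ _).trans (hle e)⟩

namespace Model

/-! ### The pairing function -/

theorem exists_double (s : M.N) : ∃ z, z + z = s * (s + 1) := by
  have : ∃ z, z ≤ s * (s + 1) ∧ z + z = s * (s + 1) := by
    induction s using Model.ind with
    | hP => infer_instance
    | h₀ => exact ⟨0, zero_le' _, by simp⟩
    | h₁ s ih =>
      obtain ⟨z, _, hz⟩ := ih
      have e : z + s + 1 + (z + s + 1) = (s + 1) * (s + 1 + 1) := by linear_combination hz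
      exact ⟨z + s + 1, e ▸ le_add _ _, e⟩
  obtain ⟨z, _, hz⟩ := this
  exact ⟨z, hz⟩

theorem double_inj {x y : M.N} (h : x + x = y + y) : x = y := by
  simp only [zeq, map_add] at *
  linarith

/-- The pair `⟨x, y⟩`. -/
noncomputable def pair (x y : M.N) : M.N :=
  mu ((x + y) * (x + y + 1) + (y + y) + 1) (fun z => z + z = (x + y) * (x + y + 1) + (y + y))

instance F0.pair {E : Type} [Ctx M E] (f g : E → M.N) [hf : F0 M f] [hg : F0 M g] :
    F0 M (fun e => pair (f e) (g e)) := by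
  have := F0.comp (M := M) (fun q : E × M.N => q.1) f
  have := F0.comp (M := M) (fun q : E × M.N => q.1) g
  unfold Model.pair
  infer_instance

theorem pair_spec (x y : M.N) : pair x y + pair x y = (x + y) * (x + y + 1) + (y + y) := by
  obtain ⟨z, hz⟩ := exists_double (x + y)
  have e : z + y + (z + y) = (x + y) * (x + y + 1) + (y + y) := by linear_combination hz
  exact (mu_spec (P := fun z => z + z = (x + y) * (x + y + 1) + (y + y)) inferInstance
    ⟨z + y, lt_succ_iff.2 (e ▸ le_add _ _), e⟩).2

theorem eq_pair_iff {x y z : M.N} :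
    z = pair x y ↔ z + z = (x + y) * (x + y + 1) + (y + y) :=
  ⟨fun h => h ▸ pair_spec x y, fun h => double_inj (h.trans (pair_spec x y).symm)⟩

/-- With `s = x + y`, the pairs on the diagonal `s` lie between `s(s+1)/2` and `s(s+1)/2 + s`, hence
below the start of the next diagonal. Injectivity of the pairing follows. -/
theorem pair_lt_of_add_lt {x y x' y' : M.N} (h : x + y < x' + y') : pair x y < pair x' y' := by
  have h₁ := pair_spec x y
  have h₂ := pair_spec x' y'
  have := zpos x; have := zpos y; have := zpos x'; have := zpos y'
  simp only [zlt, zeq, map_add, map_mul, map_one] at *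
  nlinarith

theorem pair_inj {x y x' y' : M.N} (h : pair x y = pair x' y') : x = x' ∧ y = y' := by
  have h₀ : x + y = x' + y' := by
    rcases lt_trichotomy (x + y) (x' + y') with h₁ | h₁ | h₁
    · exact ((pair_lt_of_add_lt h₁).ne h).elim
    · exact h₁
    · exact ((pair_lt_of_add_lt h₁).ne' h).elim
  have h₁ := pair_spec x y
  rw [h, pair_spec, h₀] at h₁
  have h₂ := double_inj (add_left_cancel h₁)
  subst h₂
  exact ⟨add_right_cancel h₀, rfl⟩

theorem add_le_pair (x y : M.N) : x + y ≤ pair x y := by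
  have h₁ := pair_spec x y
  rcases eq_or_ne (x + y) 0 with h | h
  · rw [h]; exact zero_le' _
  have h₂ : 0 < x + y := lt_of_le_of_ne (zero_le' _) h.symm
  clear h
  have := zpos y
  simp only [zle, zlt, zeq, map_add, map_mul, map_one, map_zero] at *
  nlinarith

theorem left_le_pair (x y : M.N) : x ≤ pair x y := (le_add _ _).trans (add_le_pair x y)

theorem right_le_pair (x y : M.N) : y ≤ pair x y := by
  refine le_trans ?_ (add_le_pair x y)
  rw [add_comm]; exact le_add _ _

theorem pair_lt_pair {x y x' y' : M.N} (h : x ≤ x') (h' : y < y') : pair x y < pair x' y' :=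
  pair_lt_of_add_lt (add_lt_add_of_le_of_lt h h')

theorem pair_lt_sq {x y b : M.N} (h : x + y < b) : pair x y < b * b := by
  have h₁ := pair_spec x y
  have := zpos x; have := zpos y
  simp only [zlt, zeq, map_add, map_mul, map_one] at *
  nlinarith

/-! ### Remainders -/

/-- The remainder of `a` modulo `p`. -/
noncomputable def rem (a p : M.N) : M.N := mu p (fun r => ∃ q, q ≤ a ∧ a = p * q + r)

instance F0.rem {E : Type} [Ctx M E] (f g : E → M.N) [hf : F0 M f] [hg : F0 M g] :
    F0 M (fun e => rem (f e) (g e)) := by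
  have := F0.comp (M := M) (fun q : E × M.N => q.1) f
  have := F0.comp (M := M) (fun q : (E × M.N) × M.N => q.1.1) f
  have := F0.comp (M := M) (fun q : (E × M.N) × M.N => q.1.1) g
  unfold Model.rem
  infer_instance

theorem exists_div_mod {p : M.N} (hp : 0 < p) (a : M.N) :
    ∃ r, r < p ∧ ∃ q, q ≤ a ∧ a = p * q + r := by
  induction a using Model.ind with
  | hP => infer_instance
  | h₀ => exact ⟨0, hp, 0, zero_le' _, by simp⟩
  | h₁ a ih =>
    obtain ⟨r, hr, q, hq, h⟩ := ih
    rcases eq_or_ne (r + 1) p with h₁ | h₁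
    · refine ⟨0, hp, q + 1, add_le_add_left hq 1, ?_⟩
      rw [h, mul_add, mul_one, add_zero, add_assoc, h₁]
    · exact ⟨r + 1, lt_of_le_of_ne (succ_le_iff.2 hr) h₁, q, hq.trans (le_add _ _),
        by rw [h]; ring⟩

theorem rem_spec {p : M.N} (hp : 0 < p) (a : M.N) :
    rem a p < p ∧ ∃ q, q ≤ a ∧ a = p * q + rem a p :=
  mu_spec inferInstance (exists_div_mod hp a)

theorem div_mod_unique {p q r q' r' : M.N} (hr : r < p) (hr' : r' < p)
    (h : p * q + r = p * q' + r') : r = r' := by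
  rcases lt_trichotomy q q' with h₁ | rfl | h₁
  · obtain ⟨d, rfl⟩ := exists_add_of_le (succ_le_iff.2 h₁)
    exfalso
    have h₂ : r = p + (p * d + r') := by
      refine add_left_cancel (a := p * q) (h.trans ?_); ring
    exact (hr.trans_le (le_add p (p * d + r'))).ne h₂
  · exact add_left_cancel h
  · obtain ⟨d, rfl⟩ := exists_add_of_le (succ_le_iff.2 h₁)
    exfalso
    have h₂ : r' = p + (p * d + r) := by
      refine add_left_cancel (a := p * q') (h.symm.trans ?_); ring
    exact (hr'.trans_le (le_add p (p * d + r))).ne h₂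

/-! ### Congruence -/

/-- Congruence modulo `p`. -/
def modCon (p : M.N) : RingCon M.N where
  r a b := ∃ k l, a + p * k = b + p * l
  iseqv := ⟨fun _ => ⟨0, 0, rfl⟩, fun ⟨k, l, h⟩ => ⟨l, k, h.symm⟩,
    fun {a b c} ⟨k, l, h⟩ ⟨k', l', h'⟩ => ⟨k + k', l + l', by
      refine add_right_cancel (b := b) ?_
      linear_combination h + h'⟩⟩
  add' := fun ⟨k, l, h⟩ ⟨k', l', h'⟩ => ⟨k + k', l + l', by linear_combination h + h'⟩
  mul' := fun {a b c d} ⟨k, l, h⟩ ⟨k', l', h'⟩ =>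
    ⟨k * c + a * k' + p * (k * k'), l * d + b * l' + p * (l * l'), by
      calc _ = (a + p * k) * (c + p * k') := by ring
        _ = (b + p * l) * (d + p * l') := by rw [h, h']
        _ = _ := by ring⟩

/-- The ring of residues modulo `p`. -/
def Res (p : M.N) : Type := (modCon p).Quotient

instance (p : M.N) : CommSemiring (Res p) := inferInstanceAs (CommSemiring (modCon p).Quotient)

/-- The residue of a number. -/
def res (p : M.N) : M.N →+* Res p := (modCon p).mk'

theorem res_eq_iff {p a b : M.N} : res p a = res p b ↔ ∃ k l, a + p * k = b + p * l :=
  RingCon.eq (modCon p)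

theorem res_surj {p : M.N} (x : Res p) : ∃ a, res p a = x := Quotient.exists_rep x

theorem res_self (p : M.N) : res p p = 0 := by
  rw [← map_zero (res p), res_eq_iff]
  exact ⟨0, 1, by ring⟩

theorem res_rem {p : M.N} (hp : 0 < p) (a : M.N) : res p (rem a p) = res p a := by
  obtain ⟨q, _, h⟩ := (rem_spec hp a).2
  rw [res_eq_iff]
  exact ⟨q, 0, by rw [add_comm, ← h]; simp⟩

theorem res_inj {p a b : M.N} (ha : a < p) (hb : b < p) (h : res p a = res p b) : a = b := by
  obtain ⟨k, l, h⟩ := res_eq_iff.1 h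
  exact div_mod_unique (q := k) (q' := l) ha hb (by rw [add_comm, h, add_comm])

theorem rem_lt {p : M.N} (hp : 0 < p) (a : M.N) : rem a p < p := (rem_spec hp a).1

theorem rem_eq_iff {p a b : M.N} (hp : 0 < p) (hb : b < p) :
    rem a p = b ↔ res p a = res p b := by
  rw [← res_rem hp a]
  exact ⟨fun h => by rw [h], fun h => res_inj (rem_lt hp a) hb h⟩

end Model

namespace Model

variable {M : Model V1}

/-! ### Residues modulo a prime -/

/-- Multiplication by `p - 1` is negation modulo `p`. So the residues form a ring although the
numbers have no subtraction, and `linear_combination` can be used for row operations. -/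
noncomputable instance {p : M.N} [hp : Fact (0 < p)] : Neg (Res p) :=
  ⟨fun x => res p (exists_pred hp.out.ne').choose * x⟩

noncomputable instance {p : M.N} [hp : Fact (0 < p)] : CommRing (Res p) where
  zsmul := zsmulRec
  neg_add_cancel x := by
    have h := (exists_pred hp.out.ne').choose_spec
    show res p (exists_pred hp.out.ne').choose * x + x = 0
    calc _ = res p ((exists_pred hp.out.ne').choose + 1) * x := by
          rw [map_add, map_one]; ring
      _ = 0 := by rw [h, res_self, zero_mul]
  mul_comm := mul_comm

/-- `p` is a prime number of the model. -/
def IsPrime (p : M.N) : Prop := 1 < p ∧ ∀ y, y < p → ∀ z, z < p → y * z ≠ p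

theorem IsPrime.pos {p : M.N} (hp : IsPrime p) : 0 < p := (zero_le' 1).trans_lt hp.1

theorem exists_lt_res {p : M.N} (hp : 0 < p) (x : Res p) : ∃ a, a < p ∧ res p a = x := by
  obtain ⟨a, rfl⟩ := res_surj x
  exact ⟨rem a p, rem_lt hp a, res_rem hp a⟩

/-- Let `d` be the least positive remainder of a multiple of `a`. The remainder of `p` modulo `d` is
again the remainder of a multiple of `a`, so it vanishes by minimality and `d` divides `p`. As `d <
p`, primality leaves only `d = 1`. -/
theorem IsPrime.exists_inv {p : M.N} (hp : IsPrime p) {a : M.N} (ha : a < p) (ha₀ : a ≠ 0) :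
    ∃ b, b < p ∧ res p b * res p a = 1 := by
  have : Fact (0 < p) := ⟨hp.pos⟩
  obtain ⟨d, ⟨hd, b, hb, hd'⟩, hmin⟩ := exists_least
    (P := fun d => 0 < d ∧ ∃ b, b < p ∧ rem (a * b) p = d) inferInstance
    ⟨a, lt_of_le_of_ne (zero_le' _) ha₀.symm, 1, hp.1, by
      rw [mul_one, rem_eq_iff hp.pos ha]⟩
  have hdp : d < p := hd' ▸ rem_lt hp.pos _
  rw [rem_eq_iff hp.pos hdp, map_mul] at hd'
  obtain ⟨q, hq, h⟩ := (rem_spec hd p).2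
  set r := rem p d with hr
  have hrd : r < d := rem_lt hd p
  have hr₀ : r = 0 := by
    by_contra hr₀
    obtain ⟨b', hb', h'⟩ := exists_lt_res hp.pos (-(res p b * res p q))
    refine hmin r hrd ⟨lt_of_le_of_ne (zero_le' _) (Ne.symm hr₀), b', hb', ?_⟩
    rw [rem_eq_iff hp.pos (hrd.trans hdp), map_mul, h']
    have h₁ := congrArg (res p) h
    rw [res_self, map_add, map_mul] at h₁
    linear_combination h₁ - res p q * hd'
  rw [hr₀, add_zero] at h
  have hqp : q = p := by
    refine le_antisymm hq (not_lt.1 fun h' => hp.2 d hdp q h' h.symm)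
  rw [hqp] at h
  have hd₁ : d = 1 := by
    have := hp.pos
    have h₂ : d * p = 1 * p := by rw [one_mul, ← h]
    exact mul_right_cancel₀ hp.pos.ne' h₂
  rw [hd₁, map_one] at hd'
  exact ⟨b, hb, by rw [mul_comm, hd']⟩

/-! ### Vectors and matrices -/

/-- The first `a < p` with `⟨z, a⟩ ∈ A`. -/
noncomputable def look (p : M.N) (A : M.S) (z : M.N) : M.N := mu p (fun a => M.mem (pair z a) A)

/-- This holds for every set, as `look` takes the value `0` when there is no entry. Any set can thus
be read as a matrix over the residues, and `Row` only matters when membership is translated to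
entries. -/
theorem look_lt {p : M.N} (hp : 0 < p) (A : M.S) (z : M.N) : look p A z < p := mu_lt hp _

/-- There is exactly one `a < p` with `⟨z, a⟩ ∈ A`. -/
def Row (p : M.N) (A : M.S) (z : M.N) : Prop :=
  (∃ a, a < p ∧ M.mem (pair z a) A) ∧
    ∀ a, a < p → ∀ b, b < p → M.mem (pair z a) A ∧ M.mem (pair z b) A → a = b

theorem Row.mem_iff {p : M.N} {A : M.S} {z : M.N} (h : Row p A z) {a : M.N} (ha : a < p) :
    M.mem (pair z a) A ↔ look p A z = a := by
  obtain ⟨⟨b, hb, hA⟩, hu⟩ := h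
  have h₁ : look p A z = b := mu_eq hb hA fun y hy hy' =>
    hy.ne (hu y (hy.trans hb) b hb ⟨hy', hA⟩)
  rw [h₁]
  exact ⟨fun h => hu b hb a ha ⟨hA, h⟩, fun h => h ▸ hA⟩

theorem row_of_mem_iff {p : M.N} {A : M.S} {z c : M.N} (hc : c < p)
    (h : ∀ a, a < p → (M.mem (pair z a) A ↔ a = c)) : Row p A z ∧ look p A z = c := by
  have h₁ : Row p A z := ⟨⟨c, hc, (h c hc).2 rfl⟩, fun a ha b hb hab =>
    ((h a ha).1 hab.1).trans ((h b hb).1 hab.2).symm⟩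
  exact ⟨h₁, (h₁.mem_iff hc).1 ((h c hc).2 rfl)⟩

end Model

open Model

variable {M : Model V1} {E F : Type} [Ctx M E] [Ctx M F]

theorem SV.comp (π : E → F) [h : Pr M π] (g : F → M.S) [hg : SV M g] : SV M (fun e => g (π e)) := by
  obtain ⟨i, hi⟩ := hg
  obtain ⟨σ, ρ, h⟩ := h
  exact ⟨ρ i, fun e => by rw [← hi, (h e).2]⟩

instance F0.look (f g : E → M.N) (A : E → M.S) [hf : F0 M f] [hg : F0 M g] [hA : SV M A] :
    F0 M (fun e => look (f e) (A e) (g e)) := by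
  have := F0.comp (M := M) (fun q : E × M.N => q.1) g
  have := SV.comp (M := M) (fun q : E × M.N => q.1) A
  unfold Model.look
  infer_instance

namespace Model

/-- Comprehension for vectors. -/
theorem exists_vector (f : M.N → M.N) (hf : F0 M (fun q : Bool × M.N => f q.2)) {n p b : M.N}
    (hp : ∀ z, z < n → f z < p) (hb : ∀ z, z < n → ∀ a, a < p → pair z a < b) :
    ∃ X, M.len X ≤ b ∧ ∀ z, z < n → Row p X z ∧ look p X z = f z := by
  have hP : S0 M (fun q : Bool × M.N => ∃ z, z < n ∧ ∃ a, a < p ∧ q.2 = pair z a ∧ a = f z) := by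
    have := Pr.lift (M := M) (fun q : Bool × M.N => q.1)
    have := F0.comp (M := M) (fun q : (Bool × M.N) × M.N => (q.1.1, q.2)) (fun q => f q.2)
    have := F0.comp (M := M) (fun q : ((Bool × M.N) × M.N) × M.N => q.1) (fun q => f q.2)
    infer_instance
  obtain ⟨X, hX, h⟩ := M.comp (fun y => ∃ z, z < n ∧ ∃ a, a < p ∧ y = pair z a ∧ a = f z) b
  refine ⟨X, hX, fun z hz => row_of_mem_iff (hp z hz) fun a ha => ?_⟩
  rw [h _ (hb z hz a ha)]
  constructor
  · rintro ⟨z', _, a', _, h₁, h₂⟩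
    obtain ⟨rfl, rfl⟩ := pair_inj h₁
    exact h₂
  · exact fun h => ⟨z, hz, a, ha, rfl, h⟩

/-- Comprehension for matrices. -/
theorem exists_matrix (f : M.N → M.N → M.N) (hf : F0 M (fun q : (Bool × M.N) × M.N => f q.1.2 q.2))
    {m n p : M.N} (hp : ∀ i, i < m → ∀ j, j < n → f i j < p) :
    ∃ X, M.len X ≤ pair (pair m n) p ∧
      ∀ i, i < m → ∀ j, j < n → Row p X (pair i j) ∧ look p X (pair i j) = f i j := by
  have hP : S0 M (fun q : Bool × M.N => ∃ i, i < m ∧ ∃ j, j < n ∧ ∃ a, a < p ∧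
      q.2 = pair (pair i j) a ∧ a = f i j) := by
    have := Pr.lift (M := M) (fun q : Bool × M.N => q.1)
    have := Pr.lift (M := M) (fun q : (Bool × M.N) × M.N => (q.1.1, q.2))
    have := F0.comp (M := M) (fun q : ((Bool × M.N) × M.N) × M.N => ((q.1.1.1, q.1.2), q.2))
      (fun q => f q.1.2 q.2)
    have := F0.comp (M := M) (fun q : (((Bool × M.N) × M.N) × M.N) × M.N => q.1)
      (fun q => f q.1.2 q.2)
    infer_instance
  obtain ⟨X, hX, h⟩ := M.comp (fun y => ∃ i, i < m ∧ ∃ j, j < n ∧ ∃ a, a < p ∧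
    y = pair (pair i j) a ∧ a = f i j) (pair (pair m n) p)
  refine ⟨X, hX, fun i hi j hj => row_of_mem_iff (hp i hi j hj) fun a ha => ?_⟩
  rw [h _ (pair_lt_pair (pair_lt_pair hi.le hj).le ha)]
  constructor
  · rintro ⟨i', _, j', _, a', _, h₁, h₂⟩
    obtain ⟨h₃, rfl⟩ := pair_inj h₁
    obtain ⟨rfl, rfl⟩ := pair_inj h₃
    exact h₂
  · exact fun h => ⟨i, hi, j, hj, a, ha, rfl, h⟩

/-! ### Partial sums -/

/-- `σ` is the sequence of partial sums of `f 0, …, f (n - 1)` modulo `p`. -/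
def IsSums (p n : M.N) (f σ : M.N → M.N) : Prop :=
  σ 0 = 0 ∧ ∀ k, k < n → σ (k + 1) = rem (σ k + f k) p

theorem IsSums.unique {p n : M.N} {f σ τ : M.N → M.N} (h : IsSums p n f σ) (h' : IsSums p n f τ)
    (hσ : F0 M (fun q : Bool × M.N => σ q.2)) (hτ : F0 M (fun q : Bool × M.N => τ q.2)) :
    σ n = τ n := by
  have : ∀ k, k ≤ n → σ k = τ k := by
    intro k
    induction k using Model.ind with
    | hP => infer_instance
    | h₀ => exact fun _ => h.1.trans h'.1.symm
    | h₁ k ih =>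
      intro hk
      have hk := succ_le_iff.1 hk
      rw [h.2 k hk, h'.2 k hk, ih hk.le]
  exact this n le_rfl

/-- There is a table of all partial sums of the products of the rows of a matrix with a vector. -/
theorem exists_table {p : M.N} (hp : 0 < p) (A X : M.S) (m n : M.N) :
    ∃ T, ∀ i, i < m →
      IsSums p n (fun k => look p A (pair i k) * look p X k) (fun k => look p T (pair i k)) := by
  -- Σ₁-induction on the number of computed columns. All rows are treated in one set, so no choice
  -- of a separate sequence for each row is needed.
  have key : ∀ l, ∃ T, M.len T ≤ pair (pair m (n + 1)) p ∧ (l ≤ n → ∀ i, i < m →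
      look p T (pair i 0) = 0 ∧ ∀ k, k < l → look p T (pair i (k + 1)) =
        rem (look p T (pair i k) + look p A (pair i k) * look p X k) p) := by
    intro l
    induction l using Model.ind₁ with
    | hP => infer_instance
    | h₀ =>
      obtain ⟨T, hT, h⟩ := exists_matrix (fun _ _ => 0) inferInstance (m := m) (n := n + 1)
        (p := p) (fun _ _ _ _ => hp)
      exact ⟨T, hT, fun _ i hi => ⟨(h i hi 0 (zero_lt_succ _)).2,
        fun k hk => (hk.not_ge (zero_le' _)).elim⟩⟩
    | h₁ l ih =>
      obtain ⟨T, -, h⟩ := ih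
      classical
      -- All columns beyond `l` receive the next partial sum; only the column `l + 1` is used at
      -- this stage.
      obtain ⟨T', hT', h'⟩ := exists_matrix (fun i j => if j ≤ l then look p T (pair i j) else
        rem (look p T (pair i l) + look p A (pair i l) * look p X l) p) inferInstance
        (m := m) (n := n + 1) (p := p) (fun i _ j _ => by
          split_ifs
          · exact look_lt hp _ _
          · exact rem_lt hp _)
      refine ⟨T', hT', fun hl i hi => ?_⟩
      have hl := succ_le_iff.1 hl
      obtain ⟨h₀, h₁⟩ := h hl.le i hi
      refine ⟨?_, fun k hk => ?_⟩
      · rw [(h' i hi 0 (zero_lt_succ _)).2, if_pos (zero_le' _), h₀]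
      · have hkl := lt_succ_iff.1 hk
        rw [(h' i hi (k + 1) (lt_succ_iff.2 (succ_le_iff.2 (hkl.trans_lt hl)))).2,
          (h' i hi k (lt_succ_iff.2 (hkl.trans hl.le))).2, if_pos hkl]
        rcases hkl.lt_or_eq with hkl | rfl
        · rw [if_pos (succ_le_iff.2 hkl), h₁ k hkl]
        · rw [if_neg (not_le.2 (lt_succ_iff.2 le_rfl))]
  obtain ⟨T, -, h⟩ := key n
  exact ⟨T, fun i hi => h le_rfl i hi⟩

end Model

namespace Model

variable {M : Model V1}

/-! ### Row echelon form and row operations -/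

/-- The first non-zero entry of the row `i` is in the column `j`. -/
def Lead (f : M.N → M.N → M.N) (i j : M.N) : Prop := f i j ≠ 0 ∧ ∀ k, k < j → f i k = 0

/-- The first `k` columns of the `m`-row matrix `f` are in row-echelon form, with `r` pivots. -/
def Echelon (m k : M.N) (f : M.N → M.N → M.N) : Prop :=
  ∃ r, r ≤ m ∧ (∀ i, i < r → ∃ j, j < k ∧ Lead f i j ∧ f i j = 1) ∧
    (∀ i, i < r → i + 1 < r → ∀ j, j < k → Lead f (i + 1) j → ∃ j', j' < j ∧ Lead f i j') ∧
    ∀ i, i < m → r ≤ i → ∀ j, j < k → f i j = 0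

/-- All rows of `f` are linear combinations of two rows of `g`. -/
def Comb (p m n : M.N) (f g : M.N → M.N → M.N) : Prop :=
  ∀ i, i < m → ∃ u, u < m ∧ ∃ v, v < m ∧ ∃ α, α < p ∧ ∃ β, β < p ∧
    ∀ j, j < n → f i j = rem (α * g u j + β * g v j) p

theorem Lead.congr {f g : M.N → M.N → M.N} {i j : M.N} (h : ∀ k, k ≤ j → f i k = g i k)
    (hf : Lead f i j) : Lead g i j :=
  ⟨h j le_rfl ▸ hf.1, fun k hk => h k hk.le ▸ hf.2 k hk⟩

theorem Lead.unique {f : M.N → M.N → M.N} {i j k : M.N} (h : Lead f i j) (h' : Lead f i k) :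
    j = k := by
  rcases lt_trichotomy j k with h₁ | h₁ | h₁
  · exact (h.1 (h'.2 j h₁)).elim
  · exact h₁
  · exact (h'.1 (h.2 k h₁)).elim

theorem Echelon.congr {m n k : M.N} {f g : M.N → M.N → M.N} (hk : k ≤ n)
    (h : ∀ i, i < m → ∀ j, j < n → f i j = g i j) (hf : Echelon m k f) : Echelon m k g := by
  obtain ⟨r, hr, h₁, h₂, h₃⟩ := hf
  have hl : ∀ i, i < m → ∀ j, j < k → (Lead f i j ↔ Lead g i j) := fun i hi j hj =>
    ⟨Lead.congr fun l hl => h i hi l (hl.trans_lt (hj.trans_le hk)),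
      Lead.congr fun l hl => (h i hi l (hl.trans_lt (hj.trans_le hk))).symm⟩
  refine ⟨r, hr, fun i hi => ?_, fun i hi hi' j hj hj' => ?_, fun i hi hri j hj => ?_⟩
  · obtain ⟨j, hj, h₄, h₅⟩ := h₁ i hi
    exact ⟨j, hj, (hl i (hi.trans_le hr) j hj).1 h₄, h i (hi.trans_le hr) j (hj.trans_le hk) ▸ h₅⟩
  · obtain ⟨j', h₄, h₅⟩ := h₂ i hi hi' j hj ((hl _ (hi'.trans_le hr) j hj).2 hj')
    exact ⟨j', h₄, (hl i (hi.trans_le hr) j' (h₄.trans hj)).1 h₅⟩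
  · rw [← h i hi j (hj.trans_le hk)]
    exact h₃ i hi hri j hj

theorem Comb.congr {p m n : M.N} {f g f' g' : M.N → M.N → M.N}
    (h : ∀ i, i < m → ∀ j, j < n → f i j = f' i j) (h' : ∀ i, i < m → ∀ j, j < n → g i j = g' i j)
    (hf : Comb p m n f g) : Comb p m n f' g' := by
  intro i hi
  obtain ⟨u, hu, v, hv, α, hα, β, hβ, h₁⟩ := hf i hi
  refine ⟨u, hu, v, hv, α, hα, β, hβ, fun j hj => ?_⟩
  rw [← h i hi j hj, ← h' u hu j hj, ← h' v hv j hj, h₁ j hj]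

/-- The elimination step for the column `k`. -/
theorem Echelon.step {p m n k : M.N} (hp : IsPrime p) (hk : k < n) (A : M.S)
    (hA : Echelon m k (fun i j => look p A (pair i j))) :
    ∃ A', Echelon m (k + 1) (fun i j => look p A' (pair i j)) ∧
      Comb p m n (fun i j => look p A (pair i j)) (fun i j => look p A' (pair i j)) ∧
      Comb p m n (fun i j => look p A' (pair i j)) (fun i j => look p A (pair i j)) := by
  have : Fact (0 < p) := ⟨hp.pos⟩
  have hp₀ := hp.pos
  obtain ⟨r, hr, h₁, h₂, h₃⟩ := hA
  set f : M.N → M.N → M.N := fun i j => look p A (pair i j) with hf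
  have hfp : ∀ i j, f i j < p := fun i j => look_lt hp₀ _ _
  have hself : ∀ a, a < p → a = rem (1 * a + 0 * a) p := fun a ha => by
    rw [eq_comm, rem_eq_iff hp₀ ha]; simp
  have hlead : ∀ i, i < r → ∀ j, Lead f i j → j < k := fun i hi j hj => by
    obtain ⟨j', hj', h, _⟩ := h₁ i hi
    rw [hj.unique h]; exact hj'
  -- Without a non-zero entry of column `k` at or below row `r`, the matrix and the number of pivots
  -- stay unchanged.
  by_cases hz : ∀ i, i < m → r ≤ i → f i k = 0
  · refine ⟨A, ⟨r, hr, fun i hi => ?_, fun i hi hi' j hj hj' => ?_, fun i hi hri j hj => ?_⟩, ?_, ?_⟩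
    · obtain ⟨j, hj, h⟩ := h₁ i hi
      exact ⟨j, hj.trans_le (le_add _ _), h⟩
    · exact h₂ i hi hi' j (hlead _ hi' j hj') hj'
    · rcases (lt_succ_iff.1 hj).lt_or_eq with hj | rfl
      · exact h₃ i hi hri j hj
      · exact hz i hi hri
    all_goals exact fun i hi => ⟨i, hi, i, hi, 1, hp.1, 0, hp₀, fun j _ => hself _ (hfp i j)⟩
  push Not at hz
  obtain ⟨l, hl, hrl, hlk⟩ := hz
  obtain ⟨c, hc, hc₁⟩ := hp.exists_inv (hfp l k) hlk
  obtain ⟨d, hd, hd₁⟩ := exists_lt_res hp₀ (-res p c)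
  have hrm : r < m := hrl.trans_lt hl
  classical
  -- The whole step in one formula: rows `r` and `l` are exchanged, the pivot row is scaled by the
  -- inverse `c` of the pivot, and each row below loses its multiple of it, where `d` represents
  -- `-c`. For `i > r`, `s i` is the old position of the row now at `i`.
  let s : M.N → M.N := fun i => if i = l then r else i
  let g : M.N → M.N → M.N := fun i j => if i < r then f i j else if i = r then rem (c * f l j) p
    else rem (f (s i) j + d * f (s i) k * f l j) p
  have hgp : ∀ i j, g i j < p := fun i j => by
    simp only [g]; split_ifs
    · exact hfp _ _
    · exact rem_lt hp₀ _
    · exact rem_lt hp₀ _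
  have hs : ∀ i, i < m → r < i → r ≤ s i ∧ s i < m := fun i hi hri => by
    simp only [s]; split_ifs
    · exact ⟨le_rfl, hrm⟩
    · exact ⟨hri.le, hi⟩
  have g₁ : ∀ i j, i < r → g i j = f i j := fun i j hi => by simp only [g, if_pos hi]
  have g₂ : ∀ j, res p (g r j) = res p c * res p (f l j) := fun j => by
    simp only [g, if_neg (lt_irrefl r), if_true, res_rem hp₀, map_mul]
  have g₃ : ∀ i j, r < i → res p (g i j) =
      res p (f (s i) j) - res p c * res p (f (s i) k) * res p (f l j) := fun i j hi => by
    simp only [g, if_neg (not_lt.2 hi.le), if_neg hi.ne', res_rem hp₀, map_mul, map_add, hd₁]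
    ring
  have g₄ : g r k = 1 := by
    refine res_inj (hgp _ _) hp.1 ?_
    rw [g₂, hc₁, map_one]
  have g₅ : ∀ j, j < k → g r j = 0 := fun j hj => by
    refine res_inj (hgp _ _) hp₀ ?_
    rw [g₂, h₃ l hl hrl j hj, map_zero, mul_zero]
  have g₆ : ∀ i, i < m → r < i → ∀ j, j ≤ k → g i j = 0 := fun i hi hri j hj => by
    refine res_inj (hgp _ _) hp₀ ?_
    rw [g₃ i j hri, map_zero]
    rcases hj.lt_or_eq with hj | rfl
    · rw [h₃ l hl hrl j hj, h₃ _ (hs i hi hri).2 (hs i hi hri).1 j hj, map_zero]; ring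
    · linear_combination (- res p (f (s i) j)) * hc₁
  have hgF : F0 M (fun q : (Bool × M.N) × M.N => g q.1.2 q.2) := by
    simp only [g, s, hf]; infer_instance
  obtain ⟨A', -, hA'⟩ := exists_matrix g hgF (m := m) (n := n) (p := p) (fun i _ j _ => hgp i j)
  have hA' : ∀ i, i < m → ∀ j, j < n → g i j = look p A' (pair i j) :=
    fun i hi j hj => (hA' i hi j hj).2.symm
  refine ⟨A', Echelon.congr (succ_le_iff.2 hk) hA' ?_,
    Comb.congr (fun _ _ _ _ => rfl) hA' ?_, Comb.congr hA' (fun _ _ _ _ => rfl) ?_⟩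
  · have hlr : Lead g r k := ⟨by rw [g₄]; exact one_ne_zero, g₅⟩
    refine ⟨r + 1, succ_le_iff.2 hrm, fun i hi => ?_, fun i hi hi' j hj hj' => ?_,
      fun i hi hri j hj => ?_⟩
    · rcases (lt_succ_iff.1 hi).lt_or_eq with hi | rfl
      · obtain ⟨j, hj, h, h'⟩ := h₁ i hi
        exact ⟨j, hj.trans_le (le_add _ _), Lead.congr (fun k _ => (g₁ i k hi).symm) h,
          by rw [g₁ i j hi]; exact h'⟩
      · exact ⟨k, lt_succ_iff.2 le_rfl, hlr, g₄⟩
    · have hir : i < r := succ_le_iff.1 (lt_succ_iff.1 hi')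
      rcases (lt_succ_iff.1 hi').lt_or_eq with hi' | hi'
      · have hj' : Lead f (i + 1) j := Lead.congr (fun k _ => g₁ _ k hi') hj'
        obtain ⟨j', h, h'⟩ := h₂ i hir hi' j (hlead _ hi' j hj') hj'
        exact ⟨j', h, Lead.congr (fun k _ => (g₁ i k hir).symm) h'⟩
      · obtain ⟨j₀, h, h', _⟩ := h₁ i hir
        have hjk : j = k := Lead.unique (f := g) (hi' ▸ hj' : Lead g r j) hlr
        exact ⟨j₀, hjk ▸ h, Lead.congr (fun k _ => (g₁ i k hir).symm) h'⟩
    · exact g₆ i hi (succ_le_iff.1 hri) j (lt_succ_iff.1 hj)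
  · intro i hi
    -- The step is inverted row by row: the old pivot row is `f l k` times the new row `r`, and an
    -- old row below is its new version plus a multiple of the new row `r`.
    have hl' : ∀ j, f l j = rem (f l k * g r j + 0 * g r j) p := fun j => by
      rw [eq_comm, rem_eq_iff hp₀ (hfp _ _), map_add, map_mul, map_mul, g₂, map_zero]
      linear_combination (res p (f l j)) * hc₁
    rcases lt_trichotomy i r with hir | rfl | hir
    · exact ⟨i, hi, i, hi, 1, hp.1, 0, hp₀, fun j _ => by
        rw [g₁ i j hir]; exact hself _ (hfp i j)⟩
    · rcases hrl.eq_or_lt with rfl | hrl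
      · exact ⟨i, hi, i, hi, f i k, hfp _ _, 0, hp₀, fun j _ => hl' j⟩
      · refine ⟨l, hl, i, hi, 1, hp.1, f i k, hfp _ _, fun j _ => ?_⟩
        rw [eq_comm, rem_eq_iff hp₀ (hfp _ _), map_add, map_mul, map_mul, g₂, g₃ l j hrl, map_one]
        simp only [s, if_true]
        ring
    · by_cases hil : i = l
      · subst hil
        exact ⟨r, hrm, r, hrm, f i k, hfp _ _, 0, hp₀, fun j _ => hl' j⟩
      · refine ⟨i, hi, r, hrm, 1, hp.1, f i k, hfp _ _, fun j _ => ?_⟩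
        rw [eq_comm, rem_eq_iff hp₀ (hfp _ _), map_add, map_mul, map_mul, g₂, g₃ i j hir, map_one]
        simp only [s, if_neg hil]
        ring
  · intro i hi
    rcases lt_trichotomy i r with hir | rfl | hir
    · exact ⟨i, hi, i, hi, 1, hp.1, 0, hp₀, fun j _ => by
        rw [g₁ i j hir]; exact hself _ (hfp i j)⟩
    · refine ⟨l, hl, l, hl, c, hc, 0, hp₀, fun j _ => ?_⟩
      rw [eq_comm, rem_eq_iff hp₀ (hgp _ _), g₂, map_add, map_mul, map_mul, map_zero]
      ring
    · refine ⟨s i, (hs i hi hir).2, l, hl, 1, hp.1, rem (d * f (s i) k) p, rem_lt hp₀ _,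
        fun j _ => ?_⟩
      rw [eq_comm, rem_eq_iff hp₀ (hgp _ _), g₃ i j hir, map_add, map_mul, map_mul, map_one,
        res_rem hp₀, map_mul, hd₁]
      ring

set_option synthInstance.maxHeartbeats 1000000 in
set_option synthInstance.maxSize 10000 in
/-- The history of the elimination. -/
theorem exists_history {p m n : M.N} (hp : IsPrime p) (A : M.S) :
    ∃ H, (∀ i, i < m → ∀ j, j < n → look p H (pair (pair 0 i) j) = look p A (pair i j)) ∧
      (∀ t, t < n →
        Comb p m n (fun i j => look p H (pair (pair t i) j))
          (fun i j => look p H (pair (pair (t + 1) i) j)) ∧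
        Comb p m n (fun i j => look p H (pair (pair (t + 1) i) j))
          (fun i j => look p H (pair (pair t i) j))) ∧
      Echelon m n (fun i j => look p H (pair (pair n i) j)) := by
  have hp₀ := hp.pos
  -- The matrices of the run form a single matrix: row `i` of the `t`-th one has the row index `pair
  -- t i`. The length bound does not depend on `k`, as Σ₁-induction on `k` with a fixed size
  -- suffices.
  have key : ∀ k, ∃ H, M.len H ≤ pair (pair (pair (n + 1) m) n) p ∧ (k ≤ n →
      (∀ i, i < m → ∀ j, j < n → look p H (pair (pair 0 i) j) = look p A (pair i j)) ∧
      (∀ t, t < k →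
        Comb p m n (fun i j => look p H (pair (pair t i) j))
          (fun i j => look p H (pair (pair (t + 1) i) j)) ∧
        Comb p m n (fun i j => look p H (pair (pair (t + 1) i) j))
          (fun i j => look p H (pair (pair t i) j))) ∧
      Echelon m k (fun i j => look p H (pair (pair k i) j))) := by
    intro k
    induction k using Model.ind₁ with
    | hP =>
      -- After unfolding, every quantifier behind `∃ H` is a bounded number quantifier, including
      -- the witnesses of the row combinations and the number of pivots.
      simp only [Comb, Echelon, Lead]
      infer_instance
    | h₀ =>
      -- Bounded minimization decodes `i` from the row index `pair 0 i`; the values at other indices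
      -- are irrelevant.
      obtain ⟨H, hH, h⟩ := exists_matrix
        (fun ρ j => look p A (pair (mu (ρ + 1) (fun i => ρ = pair 0 i)) j)) (by infer_instance)
        (m := pair (n + 1) m) (n := n) (p := p) (fun _ _ _ _ => look_lt hp₀ _ _)
      have h₁ : ∀ i : M.N, mu (pair 0 i + 1) (fun i' => pair 0 i = pair 0 i') = i := fun i =>
        mu_eq (lt_succ_iff.2 (right_le_pair _ _)) rfl fun y hy h => hy.ne (pair_inj h).2.symm
      refine ⟨H, hH, fun _ => ⟨fun i hi j hj => ?_, fun t ht => (ht.not_ge (zero_le' _)).elim,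
        0, zero_le' _, ?_, ?_, ?_⟩⟩
      · rw [(h _ (pair_lt_pair (zero_le' _) hi) j hj).2, h₁]
      · exact fun i hi => (hi.not_ge (zero_le' _)).elim
      · exact fun i hi => (hi.not_ge (zero_le' _)).elim
      · exact fun i _ _ j hj => (hj.not_ge (zero_le' _)).elim
    | h₁ k ih =>
      obtain ⟨H, hH, h⟩ := ih
      by_cases hk : k + 1 ≤ n
      swap
      · exact ⟨H, hH, fun h' => (hk h').elim⟩
      have hk := succ_le_iff.1 hk
      obtain ⟨h₁, h₂, h₃⟩ := h hk.le
      -- The current matrix is copied out of `H` into a set of its own, to which the elimination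
      -- step applies.
      obtain ⟨B, -, hB⟩ := exists_matrix (fun i j => look p H (pair (pair k i) j)) inferInstance
        (m := m) (n := n) (p := p) (fun _ _ _ _ => look_lt hp₀ _ _)
      have hB : ∀ i, i < m → ∀ j, j < n → look p H (pair (pair k i) j) = look p B (pair i j) :=
        fun i hi j hj => (hB i hi j hj).2.symm
      obtain ⟨B', h₄, h₅, h₆⟩ := (h₃.congr hk.le hB).step hp hk B
      classical
      let u : M.N → M.N := fun ρ => mu (ρ + 1) (fun i => ρ = pair (k + 1) i)
      have hu : ∀ i, u (pair (k + 1) i) = i := fun i =>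
        mu_eq (lt_succ_iff.2 (right_le_pair _ _)) rfl fun y hy h => hy.ne (pair_inj h).2.symm
      -- The condition tests whether `ρ` is an index of a row of the matrix `k + 1`. Those rows are
      -- overwritten and the earlier history is kept.
      let f : M.N → M.N → M.N := fun ρ j => if ρ = pair (k + 1) (u ρ) then
        look p B' (pair (u ρ) j) else look p H (pair ρ j)
      obtain ⟨H', hH', h'⟩ := exists_matrix f (by simp only [f, u]; infer_instance)
        (m := pair (n + 1) m) (n := n) (p := p) (fun _ _ _ _ => by
          simp only [f]; split_ifs <;> exact look_lt hp₀ _ _)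
      have e₁ : ∀ i, i < m → ∀ j, j < n →
          look p B' (pair i j) = look p H' (pair (pair (k + 1) i) j) := fun i hi j hj => by
        rw [(h' _ (pair_lt_pair (succ_le_iff.2 (hk.trans_le (le_add _ _))) hi) j hj).2]
        simp only [f, hu, if_true]
      have e₂ : ∀ t, t ≤ k → ∀ i, i < m → ∀ j, j < n →
          look p H (pair (pair t i) j) = look p H' (pair (pair t i) j) := fun t ht i hi j hj => by
        rw [(h' _ (pair_lt_pair (ht.trans (hk.le.trans (le_add _ _))) hi) j hj).2]
        simp only [f]
        rw [if_neg]
        intro h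
        exact (lt_succ_iff.2 ht).ne (pair_inj h).1
      have e₃ : ∀ i, i < m → ∀ j, j < n → look p B (pair i j) = look p H' (pair (pair k i) j) :=
        fun i hi j hj => (hB i hi j hj).symm.trans (e₂ k le_rfl i hi j hj)
      refine ⟨H', hH', fun _ => ⟨fun i hi j hj => ?_, fun t ht => ?_, ?_⟩⟩
      · rw [← e₂ 0 (zero_le' _) i hi j hj, h₁ i hi j hj]
      · rcases (lt_succ_iff.1 ht).lt_or_eq with ht | rfl
        · exact ⟨(h₂ t ht).1.congr (e₂ t ht.le) (e₂ _ (succ_le_iff.2 ht)),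
            (h₂ t ht).2.congr (e₂ _ (succ_le_iff.2 ht)) (e₂ t ht.le)⟩
        · exact ⟨h₅.congr e₃ e₁, h₆.congr e₁ e₃⟩
      · exact h₄.congr (succ_le_iff.2 hk) e₁
  obtain ⟨H, -, h⟩ := key n
  exact ⟨H, h le_rfl⟩

end Model

namespace Model

variable {M : Model V1}

/-! ### Invariance of the solutions -/

/-- Row combinations preserve the equations `σ i n = f i n`, where `σ i` is the sequence of partial
sums of the product of the row `i` of `f` with `x`. -/
theorem Comb.equations {p m n : M.N} (hp : 0 < p) {f g σ τ : M.N → M.N → M.N} {x : M.N → M.N}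
    (h : Comb p m (n + 1) f g) (hf : ∀ i j, f i j < p)
    (hσp : ∀ i j, σ i j < p)
    (hσF : F0 M (fun q : (Bool × M.N) × M.N => σ q.1.2 q.2))
    (hτF : F0 M (fun q : (Bool × M.N) × M.N => τ q.1.2 q.2))
    (hσ : ∀ i, i < m → IsSums p n (fun k => f i k * x k) (σ i))
    (hτ : ∀ i, i < m → IsSums p n (fun k => g i k * x k) (τ i))
    (heq : ∀ i, i < m → τ i n = g i n) : ∀ i, i < m → σ i n = f i n := by
  have : Fact (0 < p) := ⟨hp⟩
  intro i hi
  obtain ⟨u, hu, v, hv, α, -, β, -, hr⟩ := h i hi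
  -- Partial sums are linear in the row, so the combination of the sums of the rows `u` and `v`
  -- obeys the recursion for `σ i`.
  have key : ∀ k, k ≤ n → rem (α * τ u k + β * τ v k) p = σ i k := by
    intro k
    induction k using Model.ind with
    | hP =>
      have h₁ : ∀ c, F0 M (fun q : Bool × M.N => τ c q.2) := fun c => by
        have := Tm.const (M := M) (E := Bool) c
        have := Pr.pair (M := M) (fun _ : Bool => c)
        have := Pr.lift (M := M) (fun e : Bool => (e, c))
        exact F0.comp (fun q : Bool × M.N => ((q.1, c), q.2)) (fun q => τ q.1.2 q.2)
      have h₂ : F0 M (fun q : Bool × M.N => σ i q.2) := by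
        have := Pr.pair (M := M) (fun _ : Bool => i)
        have := Pr.lift (M := M) (fun e : Bool => (e, i))
        exact F0.comp (fun q : Bool × M.N => ((q.1, i), q.2)) (fun q => σ q.1.2 q.2)
      have := h₁ u
      have := h₁ v
      infer_instance
    | h₀ =>
      intro _
      rw [rem_eq_iff hp (hσp _ _), (hσ i hi).1, (hτ u hu).1, (hτ v hv).1]
      simp
    | h₁ k ih =>
      intro hk
      have hk := succ_le_iff.1 hk
      have ih := ih hk.le
      have hr := hr k (hk.trans_le (le_add _ _))
      rw [eq_comm, rem_eq_iff hp (hf _ _)] at hr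
      rw [rem_eq_iff hp (hσp _ _)] at ih ⊢
      rw [(hσ i hi).2 k hk, (hτ u hu).2 k hk, (hτ v hv).2 k hk]
      simp only [map_add, map_mul, res_rem hp] at *
      linear_combination ih + res p (x k) * hr
  -- Column `n` holds the right-hand sides, to which the same row combination applies; hence `Comb`
  -- is assumed for `n + 1` columns.
  rw [← key n le_rfl, heq u hu, heq v hv, ← hr n (lt_succ_iff.2 le_rfl)]

-- Solutions and row-echelon form as read off from the formulas.

/-- `X` satisfies the equation that is given by the row `i` of `A`. -/
def RowProd (n p : M.N) (A X : M.S) (i b : M.N) : Prop :=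
  ∃ S, M.len S ≤ (n + p + 1) * (n + p + 1) ∧
    ((∀ k, k < n + 1 → Row p S k) ∧ M.mem (pair 0 0) S ∧
      ∀ k, k < n → ∃ c, c < p ∧ ∃ v, v < p ∧ ∃ t, t < p ∧ ∃ s, s < p ∧ ∃ s', s' < p ∧
        M.mem (pair (pair i k) c) A ∧ M.mem (pair k v) X ∧ (t < p ∧ rem t p = rem (c * v) p) ∧
        M.mem (pair k s) S ∧ M.mem (pair (k + 1) s') S ∧
        (s' < p ∧ rem s' p = rem (s + t) p)) ∧
    M.mem (pair n b) S

/-- Partial sums are unique by induction, so the set quantifier in `RowProd` can be traded for any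
definable sequence `σ` of partial sums; conversely, comprehension turns `σ` into a set within the
required length. Being a solution thereby becomes a Σ₀ condition. -/
theorem rowProd_iff {n p : M.N} (hp : 0 < p) {A X : M.S} {i b : M.N} (hb : b < p)
    (hA : ∀ j, j < n → Row p A (pair i j)) (hX : ∀ j, j < n → Row p X j) {σ : M.N → M.N}
    (hσF : F0 M (fun q : Bool × M.N => σ q.2)) (hσp : ∀ k, σ k < p)
    (hσ : IsSums p n (fun k => look p A (pair i k) * look p X k) σ) :
    RowProd n p A X i b ↔ σ n = b := by
  constructor
  · rintro ⟨S, -, ⟨hS, h₀, h⟩, hn⟩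
    rw [(hS n (lt_succ_iff.2 le_rfl)).mem_iff hb] at hn
    rw [← hn]
    refine hσ.unique ⟨((hS 0 (zero_lt_succ _)).mem_iff hp).1 h₀, fun k hk => ?_⟩ hσF
      (τ := fun k => look p S k) inferInstance
    obtain ⟨c, hc, v, hv, t, ht, s, hs, s', hs', h₁, h₂, ⟨-, h₃⟩, h₄, h₅, -, h₆⟩ := h k hk
    show look p S (k + 1) = rem (look p S k + look p A (pair i k) * look p X k) p
    rw [((hA k hk).mem_iff hc).1 h₁, ((hX k hk).mem_iff hv).1 h₂,
      ((hS k (hk.trans_le (le_add _ _))).mem_iff hs).1 h₄,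
      ((hS (k + 1) (lt_succ_iff.2 (succ_le_iff.2 hk))).mem_iff hs').1 h₅]
    rw [rem_eq_iff hp (rem_lt hp _), res_rem hp] at h₃ h₆
    rw [eq_comm, rem_eq_iff hp hs', h₆, map_add, map_add, h₃]
  · intro hn
    obtain ⟨S, hS, h⟩ := exists_vector σ hσF (n := n + 1) (p := p)
      (b := (n + p + 1) * (n + p + 1)) (fun k _ => hσp k) (fun z hz a ha => pair_lt_sq (by
        have h₁ : z + a < (n + 1) + p := add_lt_add hz ha
        rwa [add_right_comm] at h₁))
    have hmem : ∀ k, k < n + 1 → M.mem (pair k (σ k)) S := fun k hk =>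
      ((h k hk).1.mem_iff (hσp k)).2 (h k hk).2
    refine ⟨S, hS, ⟨fun k hk => (h k hk).1, ?_, fun k hk => ?_⟩, ?_⟩
    · have := hmem 0 (zero_lt_succ _)
      rwa [hσ.1] at this
    · refine ⟨_, look_lt hp A (pair i k), _, look_lt hp X k,
        rem (look p A (pair i k) * look p X k) p, rem_lt hp _, _, hσp k, _, hσp (k + 1),
        ((hA k hk).mem_iff (look_lt hp _ _)).2 rfl, ((hX k hk).mem_iff (look_lt hp _ _)).2 rfl,
        ⟨rem_lt hp _, ?_⟩, hmem k (hk.trans_le (le_add _ _)),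
        hmem (k + 1) (lt_succ_iff.2 (succ_le_iff.2 hk)), hσp _, ?_⟩
      · rw [rem_eq_iff hp (rem_lt hp _), res_rem hp]
      · rw [hσ.2 k hk, rem_eq_iff hp (rem_lt hp _)]
        simp only [res_rem hp, map_add, map_mul]
    · rw [← hn]; exact hmem n (lt_succ_iff.2 le_rfl)

/-- `A` is an `m × n` matrix over the residues modulo `p`. -/
def IsMat (m n p : M.N) (A : M.S) : Prop := ∀ i, i < m → ∀ j, j < n → Row p A (pair i j)

/-- `X` solves the linear system with the augmented matrix `A`. -/
def Solves (m n p : M.N) (A X : M.S) : Prop :=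
  (∀ j, j < n → Row p X j) ∧
    ∀ i, i < m → ∃ b, b < p ∧ M.mem (pair (pair i n) b) A ∧ RowProd n p A X i b

/-- `A` is in row-echelon form. -/
def RowEchelon (m n : M.N) (A : M.S) : Prop :=
  let L : M.N → M.N → Prop := fun i j => ¬ M.mem (pair (pair i j) 0) A ∧
    ∀ k, k < j → M.mem (pair (pair i k) 0) A
  (∀ i, i < m → ∀ j, j < n → L i j → M.mem (pair (pair i j) 1) A) ∧
    ∀ i, i < m → i + 1 < m → ∀ j, j < n → L (i + 1) j → ∃ k, k < j ∧ L i k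

theorem solves_iff {m n p : M.N} (hp : 0 < p) {A X : M.S} (hA : IsMat m (n + 1) p A)
    (hX : ∀ j, j < n → Row p X j) {σ : M.N → M.N → M.N}
    (hσF : ∀ i, F0 M (fun q : Bool × M.N => σ i q.2)) (hσp : ∀ i k, σ i k < p)
    (hσ : ∀ i, i < m → IsSums p n (fun k => look p A (pair i k) * look p X k) (σ i)) :
    Solves m n p A X ↔ ∀ i, i < m → σ i n = look p A (pair i n) := by
  rw [Solves, and_iff_right hX]
  refine forall_congr' fun i => imp_congr_right fun hi => ?_
  have h₁ : ∀ {b}, b < p → (RowProd n p A X i b ↔ σ i n = b) := fun hb =>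
    rowProd_iff hp hb (fun j hj => hA i hi j (hj.trans_le (le_add _ _))) hX (hσF i) (hσp i)
      (hσ i hi)
  have hAn := hA i hi n (lt_succ_iff.2 le_rfl)
  constructor
  · rintro ⟨b, hb, h₂, h₃⟩
    rw [(h₁ hb).1 h₃, (hAn.mem_iff hb).1 h₂]
  · exact fun h => ⟨_, look_lt hp _ _, (hAn.mem_iff (look_lt hp _ _)).2 rfl,
      (h₁ (look_lt hp _ _)).2 h⟩

theorem Echelon.rowEchelon {m n p : M.N} (hp : 1 < p) {A : M.S} (hA : IsMat m n p A)
    (h : Echelon m n (fun i j => look p A (pair i j))) : RowEchelon m n A := by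
  have hp₀ : 0 < p := (zero_le' 1).trans_lt hp
  have hL : ∀ i, i < m → ∀ j, j < n → ((¬ M.mem (pair (pair i j) 0) A ∧
      ∀ k, k < j → M.mem (pair (pair i k) 0) A) ↔
        Lead (fun i j => look p A (pair i j)) i j) := by
    intro i hi j hj
    refine and_congr (not_congr ((hA i hi j hj).mem_iff hp₀)) ?_
    exact forall_congr' fun k => imp_congr_right fun hk => (hA i hi k (hk.trans hj)).mem_iff hp₀
  obtain ⟨r, hr, h₁, h₂, h₃⟩ := h
  have hir : ∀ i, i < m → ∀ j, j < n → Lead (fun i j => look p A (pair i j)) i j → i < r :=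
    fun i hi j hj h => not_le.1 fun hri => h.1 (h₃ i hi hri j hj)
  refine ⟨fun i hi j hj h => ?_, fun i hi hi' j hj h => ?_⟩
  · have h := (hL i hi j hj).1 h
    obtain ⟨j', hj', h', h₄⟩ := h₁ i (hir i hi j hj h)
    rw [(hA i hi j hj).mem_iff hp, h.unique h']
    exact h₄
  · have h := (hL _ hi' j hj).1 h
    have hir' := hir _ hi' j hj h
    obtain ⟨k, hk, h'⟩ := h₂ i ((le_add _ _).trans_lt hir') hir' j hj h
    exact ⟨k, hk, (hL i hi k (hk.trans hj)).2 h'⟩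

/-- Gaussian elimination in a model of `V1`. -/
theorem gauss {m n p : M.N} (hp : IsPrime p) (A : M.S) (hA : IsMat m (n + 1) p A) :
    ∃ A', IsMat m (n + 1) p A' ∧ RowEchelon m (n + 1) A' ∧
      ∀ X, Solves m n p A X ↔ Solves m n p A' X := by
  have hp₀ := hp.pos
  -- All `n + 1` columns are eliminated, including the right-hand sides, since the augmented matrix
  -- is to be in row-echelon form.
  obtain ⟨H, h₀, hstep, hech⟩ := exists_history (m := m) (n := n + 1) hp A
  obtain ⟨A', -, hA'⟩ := exists_matrix (fun i j => look p H (pair (pair (n + 1) i) j))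
    (by infer_instance) (m := m) (n := n + 1) (p := p) (fun _ _ _ _ => look_lt hp₀ _ _)
  have hmat : IsMat m (n + 1) p A' := fun i hi j hj => (hA' i hi j hj).1
  refine ⟨A', hmat, (hech.congr le_rfl fun i hi j hj => (hA' i hi j hj).2.symm).rowEchelon hp.1
    hmat, fun X => ?_⟩
  by_cases hX : ∀ j, j < n → Row p X j
  swap
  · exact ⟨fun h => (hX h.1).elim, fun h => (hX h.1).elim⟩
  -- One table serves all matrices of the history: its row indices cover `pair t i` for `t ≤ n + 1`
  -- and `i < m`.
  obtain ⟨T, hT⟩ := exists_table hp₀ H X (pair (n + 1 + 1) m) n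
  have hT : ∀ t, t < n + 1 + 1 → ∀ i, i < m → IsSums p n
      (fun k => look p H (pair (pair t i) k) * look p X k)
      (fun k => look p T (pair (pair t i) k)) :=
    fun t ht i hi => hT _ (pair_lt_pair ht.le hi)
  have e : ∀ t {B : M.S}, t < n + 1 + 1 → IsMat m (n + 1) p B →
      (∀ i, i < m → ∀ j, j < n + 1 → look p H (pair (pair t i) j) = look p B (pair i j)) →
      (Solves m n p B X ↔
        ∀ i, i < m → look p T (pair (pair t i) n) = look p H (pair (pair t i) n)) := by
    intro t B ht hB h
    rw [solves_iff hp₀ hB hX (σ := fun i k => look p T (pair (pair t i) k))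
      (fun i => by infer_instance) (fun _ _ => look_lt hp₀ _ _) (fun i hi =>
        ⟨(hT t ht i hi).1, fun k hk => by
          beta_reduce; rw [← h i hi k (hk.trans_le (le_add _ _))]; exact (hT t ht i hi).2 k hk⟩)]
    exact forall_congr' fun i => imp_congr_right fun hi => by
      rw [h i hi n (lt_succ_iff.2 le_rfl)]
  rw [e 0 (zero_lt_succ _) hA h₀, e (n + 1) (lt_succ_iff.2 le_rfl) hmat
    (fun i hi j hj => (hA' i hi j hj).2.symm)]
  -- With `H`, `T` and `X` fixed, the equivalence with the first system is Σ₀, so plain induction on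
  -- `t` applies.
  have key : ∀ t, t ≤ n + 1 →
      ((∀ i, i < m → look p T (pair (pair 0 i) n) = look p H (pair (pair 0 i) n)) ↔
        ∀ i, i < m → look p T (pair (pair t i) n) = look p H (pair (pair t i) n)) := by
    intro t
    induction t using Model.ind with
    | hP => infer_instance
    | h₀ => exact fun _ => Iff.rfl
    | h₁ t ih =>
      intro ht
      have ht := succ_le_iff.1 ht
      rw [ih ht.le]
      have ht₁ : t < n + 1 + 1 := ht.trans_le (le_add _ _)
      have ht₂ : t + 1 < n + 1 + 1 := lt_succ_iff.2 (succ_le_iff.2 ht)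
      constructor
      · exact (hstep t ht).2.equations hp₀ (x := fun k => look p X k)
          (σ := fun i k => look p T (pair (pair (t + 1) i) k))
          (τ := fun i k => look p T (pair (pair t i) k)) (fun _ _ => look_lt hp₀ _ _)
          (fun _ _ => look_lt hp₀ _ _) (by infer_instance) (by infer_instance)
          (fun i hi => hT _ ht₂ i hi) (fun i hi => hT _ ht₁ i hi)
      · exact (hstep t ht).1.equations hp₀ (x := fun k => look p X k)
          (τ := fun i k => look p T (pair (pair (t + 1) i) k))
          (σ := fun i k => look p T (pair (pair t i) k)) (fun _ _ => look_lt hp₀ _ _)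
          (fun _ _ => look_lt hp₀ _ _) (by infer_instance) (by infer_instance)
          (fun i hi => hT _ ht₁ i hi) (fun i hi => hT _ ht₂ i hi)
  exact key _ le_rfl

end Model

open Model

/-! ### The meaning of the formulas about matrices -/

section Meaning

variable {M : Model V1} (v : ℕ → M.N) (w : ℕ → M.S)

theorem sat_isPair (x y z : NTerm) : Sat M.toStr v w (isPair x y z) ↔
    z.eval M.toStr v w = pair (x.eval M.toStr v w) (y.eval M.toStr v w) := by
  rw [eq_pair_iff]; simp [isPair]

theorem sat_mem₂ (X : ℕ) (x y : NTerm) : Sat M.toStr v w (mem₂ X x y) ↔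
    M.mem (pair (x.eval M.toStr v w) (y.eval M.toStr v w)) (w X) := by
  simp only [mem₂, sat_exLt, sat_and, sat_isPair, sat_mem, eval_len, NTerm.eval_shiftN, eval_var,
    scons_zero]
  constructor
  · rintro ⟨_, _, rfl, h⟩
    exact h
  · exact fun h => ⟨_, lt_len h, rfl, h⟩

/-- The bounds in the formula lose nothing: elements of a set lie below its length, and a pair is at
least as large as its first component. -/
theorem sat_mem₃ (X : ℕ) (x y z : NTerm) : Sat M.toStr v w (mem₃ X x y z) ↔
    M.mem (pair (pair (x.eval M.toStr v w) (y.eval M.toStr v w)) (z.eval M.toStr v w)) (w X) := by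
  simp only [mem₃, sat_exLt, sat_exLe, sat_and, sat_isPair, sat_mem, eval_len, NTerm.eval_shiftN,
    eval_var, scons_zero, scons_one]
  constructor
  · rintro ⟨_, _, ⟨_, _, rfl, rfl⟩, h⟩
    exact h
  · exact fun h => ⟨_, lt_len h, ⟨_, left_le_pair _ _, rfl, rfl⟩, h⟩

/-- Positivity of the modulus matters: for modulus `0` the formula fails because of `r < p`, while
`rem` has the default value `0`. -/
theorem sat_isRem (a p r : NTerm) (hp : 0 < p.eval M.toStr v w) :
    Sat M.toStr v w (isRem a p r) ↔
      r.eval M.toStr v w = rem (a.eval M.toStr v w) (p.eval M.toStr v w) := by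
  simp only [isRem, sat_exLe, sat_and, sat_lt, sat_eqN, eval_add, eval_mul, NTerm.eval_shiftN,
    eval_var, scons_zero]
  constructor
  · rintro ⟨⟨q, _, h⟩, hr⟩
    obtain ⟨q', _, h'⟩ := (rem_spec hp (a.eval M.toStr v w)).2
    exact div_mod_unique hr (rem_lt hp _) (h.symm.trans h')
  · intro h
    rw [h]
    exact ⟨(rem_spec hp _).2, rem_lt hp _⟩

theorem sat_congr (a b p : NTerm) (hp : 0 < p.eval M.toStr v w) :
    Sat M.toStr v w (congr a b p) ↔
      rem (a.eval M.toStr v w) (p.eval M.toStr v w) =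
        rem (b.eval M.toStr v w) (p.eval M.toStr v w) := by
  simp only [congr, sat_exLt, sat_and]
  constructor
  · rintro ⟨r, hr, h₁, h₂⟩
    rw [sat_isRem _ _ _ _ _ (by simpa using hp)] at h₁ h₂
    simp only [NTerm.eval_shiftN, eval_var, scons_zero] at h₁ h₂
    rw [← h₁, ← h₂]
  · intro h
    refine ⟨_, rem_lt hp (a.eval M.toStr v w), ?_, ?_⟩ <;>
      rw [sat_isRem _ _ _ _ _ (by simpa using hp)] <;>
      simp only [NTerm.eval_shiftN, eval_var, scons_zero]
    exact h

theorem sat_addMod (p a b c : NTerm) : Sat M.toStr v w (addMod p a b c) ↔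
    c.eval M.toStr v w < p.eval M.toStr v w ∧
      rem (c.eval M.toStr v w) (p.eval M.toStr v w) =
        rem (a.eval M.toStr v w + b.eval M.toStr v w) (p.eval M.toStr v w) := by
  simp only [addMod, sat_and, sat_lt]
  exact and_congr_right fun h => sat_congr v w _ _ _ ((zero_le' _).trans_lt h)

theorem sat_mulMod (p a b c : NTerm) : Sat M.toStr v w (mulMod p a b c) ↔
    c.eval M.toStr v w < p.eval M.toStr v w ∧
      rem (c.eval M.toStr v w) (p.eval M.toStr v w) =
        rem (a.eval M.toStr v w * b.eval M.toStr v w) (p.eval M.toStr v w) := by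
  simp only [mulMod, sat_and, sat_lt]
  exact and_congr_right fun h => sat_congr v w _ _ _ ((zero_le' _).trans_lt h)

theorem sat_prime (p : NTerm) : Sat M.toStr v w (prime p) ↔ IsPrime (p.eval M.toStr v w) := by
  simp [prime, IsPrime]

theorem sat_isMatrix (m n p : NTerm) (A : ℕ) : Sat M.toStr v w (isMatrix m n p A) ↔
    IsMat (m.eval M.toStr v w) (n.eval M.toStr v w) (p.eval M.toStr v w) (w A) := by
  simp only [isMatrix, IsMat, Row, sat_allLt, sat_exLt, sat_and, sat_imp, sat_mem₃, sat_eqN,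
    NTerm.eval_shiftN, eval_var, scons_zero, scons_one, scons_two, scons_three]

theorem sat_isVector (n p : NTerm) (X : ℕ) : Sat M.toStr v w (isVector n p X) ↔
    ∀ j, j < n.eval M.toStr v w → Row (p.eval M.toStr v w) (w X) j := by
  simp only [isVector, Row, sat_allLt, sat_exLt, sat_and, sat_imp, sat_mem₂, sat_eqN,
    NTerm.eval_shiftN, eval_var, scons_zero, scons_one, scons_two]

theorem sat_isRowEchelon (m n : NTerm) (A : ℕ) : Sat M.toStr v w (isRowEchelon m n A) ↔
    RowEchelon (m.eval M.toStr v w) (n.eval M.toStr v w) (w A) := by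
  simp only [isRowEchelon, RowEchelon, isLeading, sat_allLt, sat_exLt, sat_and, sat_imp, sat_neg,
    sat_mem₃, sat_lt, eval_add, eval_one, eval_zero, NTerm.eval_shiftN, eval_var, scons_zero,
    scons_one, scons_two]

theorem sat_isRowProduct (n p : NTerm) (A X : ℕ) (i b : NTerm) :
    Sat M.toStr v w (isRowProduct n p A X i b) ↔
      RowProd (n.eval M.toStr v w) (p.eval M.toStr v w) (w A) (w X) (i.eval M.toStr v w)
        (b.eval M.toStr v w) := by
  simp only [isRowProduct, isPartialSums, RowProd, sat_exSLe, sat_and, sat_isVector, sat_mem₂,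
    sat_mem₃, sat_allLt, sat_exLt, sat_mulMod, sat_addMod, eval_add, eval_mul, eval_one, eval_zero,
    NTerm.eval_shiftN, NTerm.eval_shiftS, eval_var, scons_zero, scons_succ]

theorem sat_isSolution (m n p : NTerm) (A X : ℕ) : Sat M.toStr v w (isSolution m n p A X) ↔
    Solves (m.eval M.toStr v w) (n.eval M.toStr v w) (p.eval M.toStr v w) (w A) (w X) := by
  simp only [isSolution, Solves, sat_and, sat_isVector, sat_allLt, sat_exLt, sat_mem₃,
    sat_isRowProduct, NTerm.eval_shiftN, eval_var, scons_zero, scons_one]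

end Meaning

end BoundedArith

theorem mainTheorem10 :
    BoundedArith.Proves BoundedArith.V1 BoundedArith.gaussianElimination := by
  open BoundedArith in
  refine proves_of_forall_model fun M => ?_
  simp only [gaussianElimination, sat_allN, sat_imp, sat_prime, sat_allS, sat_isMatrix, sat_exS,
    sat_and, sat_isRowEchelon, sat_iff, sat_isSolution, eval_add, eval_one, eval_var, scons_zero,
    scons_one, scons_two]
  exact fun p m n hp A hA => Model.gauss hp A hA
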